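/- For $\zeta>0$ let $K_\nu(\zeta)=\int_0^\infty\cosh(\nu\vartheta)\,e^{-\zeta\cosh\vartheta}\,d\vartheta$. For $\ell=0,1$ put $$\omega^{(\ell)}(x;\zeta)=\frac{(x^2-1)^{\ell-1/2}}{K_1(\zeta)}e^{-\zeta x}\quad(x>1),\qquad (f,g)_{\omega^{(\ell)}}=\int_1^\infty f(x)g(x)\,\omega^{(\ell)}(x;\zeta)\,dx .$$ Let $P_n^{(\ell)}(x;\zeta)$ ($n=0,1,2,\dots$) be the orthonormal polynomials for this inner product, with $\deg P_n^{(\ell)}=n$ and leading coefficient $c_n^{(\ell)}>0$. Let $\sigma_n^{(\ell)}$ denote the sum of the zeros of $P_n^{(\ell)}$ and put $$a_k^{(\ell)}=(xP_k^{(\ell)},P_{k+1}^{(\ell)})_{\omega^{(\ell)}},\quad b_k^{(\ell)}=(xP_k^{(\ell)},P_k^{(\ell)})_{\omega^{(\ell)}},$$ $$p_k=\frac{c_k^{(0)}}{c_k^{(1)}},\quad q_k=\frac{c_k^{(1)}}{c_{k+1}^{(0)}}\bigl(\sigma_{k+2}^{(0)}-\sigma_k^{(1)}\bigr),\quad r_k=\frac{c_{k-1}^{(1)}}{c_{k+1}^{(0)}}\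 (k\ge1).$$ Let $J_n^{(\ell)}$ be the symmetric tridiagonal $(n+1)\times(n+1)$ matrix with diagonal $b_0^{(\ell)},\dots,b_n^{(\ell)}$ and off-diagonal $a_0^{(\ell)},\dots,a_{n-1}^{(\ell)}$. Let $J_{n-1}$ be the $n\times(n+1)$ matrix whose row $k$ ($k=0,\dots,n-1$) has the entries $p_k,q_k,r_{k+1}$ in columns $k,k+1,k+2$ (columns are numbered from $0$ to $n$, and $r_n$ is omitted in the last row) and zeros elsewhere. For $n\ge0$ define the $(2n+1)\times(2n+1)$ matrices $$A_n^0=\begin{pmatrix}J_n^{(0)}&0\\0&J_{n-1}^{(1)}\end{pmatrix},\qquad A_n^1=\begin{pmatrix}0&J_{n-1}^T\\J_{n-1}&0\end{pmatrix}.$$ A generalized eigenvalue of the pair is a number $\hat\lambda$ such that $A_n^1y=\hat\lambda A_n^0y$ for some $y\ne0$; it is simple if it is a simple root of $\det(XA_n^0-A_n^1)$. Finally let $$Q_{2n}(x;\zeta)=P_{n+1}^{(0)}(x;\zeta)P_n^{(1)}(-x;\zeta)+P_{n+1}^{(0)}(-x;\zeta)P_n^{(1)}(x;\zeta).$$ **Theorem.**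 Let $n\ge 0$ and $\zeta>0$. The polynomial $Q_{2n}(\cdot;\zeta)$ is even of degree $2n$ and has exactly $2n$ zeros, which are real and simple. Labelled in increasing order by $i=-n,\dots,-1,1,\dots,n$, these zeros $z_{i,n}=z_{i,n}(\zeta)$ satisfy $z_{-i,n}=-z_{i,n}$, and $z_{i,n}>1$ for $i=1,\dots,n$. Put $$\hat\lambda_{i,n}=\frac{\sqrt{z_{i,n}^2-1}}{z_{i,n}},\qquad i=\pm1,\dots,\pm n .$$ Then the complex generalized eigenvalues of the pair $(A_n^0,A_n^1)$ are exactly $\hat\lambda_{0,n}=0$ and the $2n$ numbers $\hat\lambda_{i,n}$. The latter are pairwise distinct, real and non-zero with $|\hat\lambda_{i,n}|<1$, and all $2n+1$ generalized eigenvalues are simple. The functions $\zeta\mapsto\hat\lambda_{i,n}$ are differentiable, with $$\frac{\partial\hat\lambda_{i,n}}{\partial\zeta}<0\ (i=1,\dots,n),\qquad \frac{\partial\hat\lambda_{i,n}}{\partial\zeta}>0\ (i=-n,\dots,-1).$$ With $\vec P_m^{(\ell)}=(P_0^{(\ell)},\dots,P_m^{(\ell)})^T$, the eigenvectors are, up to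 scalar factors, the non-zero vectors $y_{i,n}=(u_{i,n}^T,v_{i,n}^T)^T$, where for $i=\pm1,\dots,\pm n$ and $z=z_{i,n}$ $$u_{i,n}=\vec P_n^{(0)}(z;\zeta)P_n^{(1)}(-z;\zeta)+\vec P_n^{(0)}(-z;\zeta)P_n^{(1)}(z;\zeta),$$ $$v_{i,n}=\sqrt{z^2-1}\,\bigl(\vec P_{n-1}^{(1)}(z;\zeta)P_n^{(1)}(-z;\zeta)-\vec P_{n-1}^{(1)}(-z;\zeta)P_n^{(1)}(z;\zeta)\bigr),$$ and $$u_{0,n}=\vec P_n^{(0)}(1;\zeta)P_{n+1}^{(0)}(-1;\zeta)-\vec P_n^{(0)}(-1;\zeta)P_{n+1}^{(0)}(1;\zeta),\qquad v_{0,n}=0 .$$ -/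

import Mathlib

open Polynomial

noncomputable section

namespace RelOP

/-- Modified Bessel function of the second kind,
`K_ν(ζ) = ∫_0^∞ cosh(ν θ) exp(-ζ cosh θ) dθ`. -/
def besselK (ν ζ : ℝ) : ℝ :=
  ∫ θ in Set.Ioi (0 : ℝ), Real.cosh (ν * θ) * Real.exp (-ζ * Real.cosh θ)

/-- The weight `ω^(ℓ)(x; ζ) = (x² - 1)^(ℓ - 1/2) exp(-ζ x) / K_1(ζ)`. -/
def weight (l : ℕ) (ζ x : ℝ) : ℝ :=
  (x ^ 2 - 1) ^ ((l : ℝ) - 1 / 2) / besselK 1 ζ * Real.exp (-ζ * x)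

/-- The weighted inner product `(f, g)_{ω^(ℓ)} = ∫_1^∞ f g ω^(ℓ) dx` of two polynomials. -/
def ip (l : ℕ) (ζ : ℝ) (f g : ℝ[X]) : ℝ :=
  ∫ x in Set.Ioi (1 : ℝ), f.eval x * g.eval x * weight l ζ x

/-- The monic orthogonal polynomials for `ω^(ℓ)`, by Gram-Schmidt applied to `1, X, X², …`. -/
def monicOP (l : ℕ) (ζ : ℝ) (n : ℕ) : ℝ[X] :=
  X ^ n - ∑ k : Fin n,
    C (ip l ζ (X ^ n) (monicOP l ζ k) / ip l ζ (monicOP l ζ k) (monicOP l ζ k)) * monicOP l ζ k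
termination_by n
decreasing_by exact k.isLt

/-- The orthonormal polynomials `P_n^(ℓ)(x; ζ)` with positive leading coefficient. -/
def P (l : ℕ) (ζ : ℝ) (n : ℕ) : ℝ[X] :=
  C (Real.sqrt (ip l ζ (monicOP l ζ n) (monicOP l ζ n)))⁻¹ * monicOP l ζ n

/-- Leading coefficient `c_n^(ℓ)` of `P_n^(ℓ)`. -/
def lc (l : ℕ) (ζ : ℝ) (n : ℕ) : ℝ := (P l ζ n).leadingCoeff

/-- Sum of the zeros of `P_n^(ℓ)`. -/
def zeroSum (l : ℕ) (ζ : ℝ) (n : ℕ) : ℝ := (P l ζ n).roots.sum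

/-- `a_n^(ℓ) = (x P_n^(ℓ), P_{n+1}^(ℓ))`. -/
def aCoef (l : ℕ) (ζ : ℝ) (n : ℕ) : ℝ := ip l ζ (X * P l ζ n) (P l ζ (n + 1))

/-- `b_n^(ℓ) = (x P_n^(ℓ), P_n^(ℓ))`. -/
def bCoef (l : ℕ) (ζ : ℝ) (n : ℕ) : ℝ := ip l ζ (X * P l ζ n) (P l ζ n)

/-- `p_n = c_n^(0) / c_n^(1)`. -/
def pCoef (ζ : ℝ) (n : ℕ) : ℝ := lc 0 ζ n / lc 1 ζ n

/-- `q_n = (c_n^(1) / c_{n+1}^(0)) (∑ zeros of P_{n+2}^(0) - ∑ zeros of P_n^(1))`. -/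
def qCoef (ζ : ℝ) (n : ℕ) : ℝ :=
  lc 1 ζ n / lc 0 ζ (n + 1) * (zeroSum 0 ζ (n + 2) - zeroSum 1 ζ n)

/-- `r_n = c_{n-1}^(1) / c_{n+1}^(0)`; only used for `n ≥ 1`. -/
def rCoef (ζ : ℝ) (n : ℕ) : ℝ := lc 1 ζ (n - 1) / lc 0 ζ (n + 1)

/-- The symmetric tridiagonal Jacobi matrix of size `m × m` with diagonal `b_0, …, b_{m-1}` and
off-diagonal `a_0, …, a_{m-2}`, i.e. `J_{m-1}^(ℓ)` when matrices are indexed by their last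
row number (indexed by their size here, so that the empty matrix is included). -/
def jacobi (l : ℕ) (ζ : ℝ) (m : ℕ) : Matrix (Fin m) (Fin m) ℝ :=
  Matrix.of fun i j =>
    if i = j then bCoef l ζ i
    else if (j : ℕ) = i + 1 then aCoef l ζ i
    else if (i : ℕ) = j + 1 then aCoef l ζ j
    else 0

/-- The `m × (m+1)` upper triangular banded matrix `J_{m-1}`, whose `i`-th row carries
`p_i, q_i, r_{i+1}` in columns `i, i+1, i+2` (the entry `r_m` of the last row is cut off). -/
def mixed (ζ : ℝ) (m : ℕ) : Matrix (Fin m) (Fin (m + 1)) ℝ :=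
  Matrix.of fun i j =>
    if (j : ℕ) = i then pCoef ζ i
    else if (j : ℕ) = i + 1 then qCoef ζ i
    else if (j : ℕ) = i + 2 then rCoef ζ (i + 1)
    else 0

/-- `A⁰_n = diag(J_n^(0), J_{n-1}^(1))`. -/
def A0 (ζ : ℝ) (n : ℕ) : Matrix (Fin (n + 1) ⊕ Fin n) (Fin (n + 1) ⊕ Fin n) ℝ :=
  Matrix.fromBlocks (jacobi 0 ζ (n + 1)) 0 0 (jacobi 1 ζ n)

/-- `A¹_n`, with off-diagonal blocks `J_{n-1}ᵀ` and `J_{n-1}`. -/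
def A1 (ζ : ℝ) (n : ℕ) : Matrix (Fin (n + 1) ⊕ Fin n) (Fin (n + 1) ⊕ Fin n) ℝ :=
  Matrix.fromBlocks 0 (mixed ζ n).transpose (mixed ζ n) 0

/-- `μ` is a generalized eigenvalue of the pair `(A, B)`: `B y = μ A y` for some `y ≠ 0`. -/
def IsGenEigenvalue {K ι : Type*} [Field K] [Fintype ι] (A B : Matrix ι ι K) (μ : K) : Prop :=
  ∃ y : ι → K, y ≠ 0 ∧ B.mulVec y = μ • A.mulVec y

/-- The polynomial `det(X A - B)`, whose root multiplicities are the algebraic multiplicities of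
the generalized eigenvalues of the pair `(A, B)`. -/
def pencilPoly {K ι : Type*} [Field K] [Fintype ι] [DecidableEq ι] (A B : Matrix ι ι K) : K[X] :=
  ((X : K[X]) • A.map (C : K →+* K[X]) - B.map (C : K →+* K[X])).det

/-- `Q_{2n}(x) = P_{n+1}^(0)(x) P_n^(1)(-x) + P_{n+1}^(0)(-x) P_n^(1)(x)`. -/
def Q (ζ : ℝ) (n : ℕ) : ℝ[X] :=
  P 0 ζ (n + 1) * (P 1 ζ n).comp (-X) + (P 0 ζ (n + 1)).comp (-X) * P 1 ζ n

/-- The index set `{±1, …, ±n}`. -/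
def idx (n : ℕ) : Set ℤ := {i | i ≠ 0 ∧ |i| ≤ (n : ℤ)}

/-- `λ̂ = √(z² - 1) / z`. -/
def lamHat (z : ℝ) : ℝ := Real.sqrt (z ^ 2 - 1) / z

/-- The vector `(P_0^(ℓ)(x), …, P_{m-1}^(ℓ)(x))` of length `m`. -/
def Pvec (l : ℕ) (ζ : ℝ) (m : ℕ) (x : ℝ) : Fin m → ℝ := fun k => (P l ζ k).eval x

/-- `P_n^(0)vec(z) P_n^(1)(-z) + P_n^(0)vec(-z) P_n^(1)(z)`. -/
def uVec (ζ : ℝ) (n : ℕ) (z : ℝ) : Fin (n + 1) → ℝ :=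
  (P 1 ζ n).eval (-z) • Pvec 0 ζ (n + 1) z + (P 1 ζ n).eval z • Pvec 0 ζ (n + 1) (-z)

/-- `√(z² - 1) (P_{n-1}^(1)vec(z) P_n^(1)(-z) - P_{n-1}^(1)vec(-z) P_n^(1)(z))`. -/
def vVec (ζ : ℝ) (n : ℕ) (z : ℝ) : Fin n → ℝ :=
  Real.sqrt (z ^ 2 - 1) •
    ((P 1 ζ n).eval (-z) • Pvec 1 ζ n z - (P 1 ζ n).eval z • Pvec 1 ζ n (-z))

/-- The eigenvector `y = (u, v)` attached to a zero `z` of `Q_{2n}`. -/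
def yVec (ζ : ℝ) (n : ℕ) (z : ℝ) : Fin (n + 1) ⊕ Fin n → ℝ :=
  Sum.elim (uVec ζ n z) (vVec ζ n z)

/-- The eigenvector for the eigenvalue `0`:
`u = P_n^(0)vec(1) P_{n+1}^(0)(-1) - P_n^(0)vec(-1) P_{n+1}^(0)(1)`, `v = 0`. -/
def yZero (ζ : ℝ) (n : ℕ) : Fin (n + 1) ⊕ Fin n → ℝ :=
  Sum.elim
    ((P 0 ζ (n + 1)).eval (-1) • Pvec 0 ζ (n + 1) 1 -
      (P 0 ζ (n + 1)).eval 1 • Pvec 0 ζ (n + 1) (-1))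
    0

end RelOP

end

open RelOP

/-! Zeros of Q. Let A, B be the monic versions of P_n^(0), P_{n+1}^(0) and S = A/B. Since ω^(1) =
(x² - 1) ω^(0), the polynomial (x² - 1) P_n^(1) is ω^(0)-orthogonal to all degrees below n, so it is
a constant times A plus a linear factor times B (`exists_christoffel`). Evaluation at ±1 eliminates
the unknown constant term of that factor, and up to a nonzero constant (x² - 1) Q(x) = B(x) B(-x)
(S(x) + S(-x) - S(1) - S(-1)) (`exists_mul_monicQ`). The zeros of B are simple and lie in (1, ∞);
the Wronskian of A and B is positive, so S has positive residues there. Hence Q changes sign across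
each of the n gaps between zeros of B; with the reflected zeros this makes 2n, which exhausts the
degree by parity.

Motion in ζ. Differentiating the weight brings down a factor -x, which yields Toda equations for A
and B and the Riccati equation ∂S/∂ζ = (x - b) S - 1 - a S² with a > 0 (`exists_riccati`). At a zero
z > 1 of Q the bracket above vanishes, and the order S(1) < S(-1) < S(-z) makes its ζ-derivative
negative (`hasDerivAt_symPoly`). Its x-derivative is negative by partial fractions (`sym_at_root`),
so z decreases with ζ, and √(z² - 1)/z increases with z > 1.

Spectrum. The blocks of A⁰ are truncations of multiplication by x, those of A¹ truncations of the
change between the two bases. Applied to vectors of polynomial values they are exact up to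
remainders proportional to P_{n+1}^(0)(x) or P_n^(1)(x). Combining the values at z and -z cancels
the second kind identically and the first kind exactly when Q(z) = 0 (`A1_mulVec_yVec`). Together
with the eigenvalue 0 this gives 2n + 1 distinct eigenvalues of a pencil of that size with det A⁰ ≠
0, so there are no others and all are simple (`pencilPoly_eq_prod`, `genEigenspace_eq_span`). -/

namespace RelOP

/-- A linear functional on `ℝ[X]` that is positive on the nonzero polynomials which are
nonnegative on `(1, ∞)`. -/
def PosFunctional (L : ℝ[X] →ₗ[ℝ] ℝ) : Prop :=
  ∀ p : ℝ[X], p ≠ 0 → (∀ x, 1 < x → 0 ≤ p.eval x) → 0 < L p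

/-- A sequence of polynomials with `deg π_n = n` and `π_n` orthogonal to all polynomials of
smaller degree. -/
structure OrthoSeq (L : ℝ[X] →ₗ[ℝ] ℝ) (π : ℕ → ℝ[X]) : Prop where
  degree_eq : ∀ n : ℕ, (π n).degree = n
  orth : ∀ (n : ℕ) (q : ℝ[X]), q.degree < (n : WithBot ℕ) → L (π n * q) = 0

variable {L : ℝ[X] →ₗ[ℝ] ℝ} {π : ℕ → ℝ[X]}

/-! ### Orthogonal polynomials of a positive functional: expansion, recurrence, Wronskian. -/

namespace OrthoSeq

theorem ne_zero (h : OrthoSeq L π) (n : ℕ) : π n ≠ 0 := by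
  intro h0
  have := h.degree_eq n
  rw [h0, degree_zero] at this
  exact absurd this (by simp)

theorem natDegree_eq (h : OrthoSeq L π) (n : ℕ) : (π n).natDegree = n :=
  natDegree_eq_of_degree_eq_some (h.degree_eq n)

theorem orth_of_ne (h : OrthoSeq L π) {i j : ℕ} (hij : i ≠ j) : L (π i * π j) = 0 := by
  rcases lt_or_gt_of_ne hij with hlt | hlt
  · rw [mul_comm]
    exact h.orth j _ (by rw [h.degree_eq]; exact_mod_cast hlt)
  · exact h.orth i _ (by rw [h.degree_eq]; exact_mod_cast hlt)

theorem sq_pos (h : OrthoSeq L π) (hL : PosFunctional L) (n : ℕ) : 0 < L (π n * π n) :=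
  hL _ (mul_ne_zero (h.ne_zero n) (h.ne_zero n)) fun x _ => by
    rw [eval_mul]; exact mul_self_nonneg _

/-- Induction on m: subtracting the multiple of `π m` with the same top coefficient lowers the
degree, and pairing with `π m` identifies that multiple. -/
theorem expand (h : OrthoSeq L π) (hL : PosFunctional L) (m : ℕ) :
    ∀ f : ℝ[X], f.degree < m →
      f = ∑ k ∈ Finset.range m, C (L (f * π k) / L (π k * π k)) * π k := by
  induction m with
  | zero =>
    intro f hf
    simpa using (degree_lt_iff_coeff_zero f 0).1 hf |> fun h => Polynomial.ext fun k => h k (by simp)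
  | succ m ih =>
    intro f hf
    set c := f.coeff m / (π m).leadingCoeff with hc
    have hlc : (π m).leadingCoeff ≠ 0 := leadingCoeff_ne_zero.2 (h.ne_zero m)
    set g := f - C c * π m with hg
    have hgd : g.degree < m := by
      rw [degree_lt_iff_coeff_zero]
      intro k hk
      rcases hk.eq_or_lt with rfl | hk
      · have : (π m).coeff m = (π m).leadingCoeff := by
          rw [leadingCoeff, h.natDegree_eq]
        rw [hg, coeff_sub, coeff_C_mul, this, hc, div_mul_cancel₀ _ hlc, sub_self]
      · rw [hg, coeff_sub, coeff_C_mul, (degree_lt_iff_coeff_zero f (m + 1)).1 hf k hk,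
          coeff_eq_zero_of_natDegree_lt (by rw [h.natDegree_eq]; exact hk)]
        simp
    have hf' : f = g + C c * π m := by rw [hg]; ring
    have hgm : L (g * π m) = 0 := by rw [mul_comm]; exact h.orth m g hgd
    have hval : ∀ k, L (f * π k) = L (g * π k) + c * L (π m * π k) := by
      intro k
      rw [hf', add_mul, map_add, mul_assoc, ← smul_eq_C_mul, map_smul, smul_eq_mul]
    rw [Finset.sum_range_succ, hval m, hgm, zero_add, mul_div_assoc,
      div_self (h.sq_pos hL m).ne', mul_one]
    conv_lhs => rw [hf', ih g hgd]
    congr 1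
    refine Finset.sum_congr rfl fun k hk => ?_
    rw [hval k, h.orth_of_ne (Finset.mem_range.1 hk).ne', mul_zero, add_zero]

/-- If `f` is orthogonal to all polynomials of degree `< m` then only the coefficients from `m`
on occur in its expansion. -/
theorem expand_add_two (h : OrthoSeq L π) (hL : PosFunctional L) {m : ℕ} {f : ℝ[X]}
    (hf : f.degree < ((m + 3 : ℕ) : WithBot ℕ))
    (ho : ∀ q : ℝ[X], q.degree < (m : WithBot ℕ) → L (f * q) = 0) :
    f = C (L (f * π m) / L (π m * π m)) * π m
      + C (L (f * π (m + 1)) / L (π (m + 1) * π (m + 1))) * π (m + 1)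
      + C (L (f * π (m + 2)) / L (π (m + 2) * π (m + 2))) * π (m + 2) := by
  conv_lhs => rw [h.expand hL (m + 3) f hf]
  rw [Finset.sum_range_succ, Finset.sum_range_succ, Finset.sum_range_succ,
    Finset.sum_eq_zero, zero_add]
  intro k hk
  rw [ho (π k) (by rw [h.degree_eq]; exact_mod_cast Finset.mem_range.1 hk)]
  simp

/-- The squared norm is the pairing with any polynomial of the same leading term. -/
theorem apply_mul_monic (h : OrthoSeq L π) (hm : ∀ n, (π n).Monic) {n : ℕ} {q : ℝ[X]}
    (hq : q.Monic) (hqd : q.degree = n) : L (π n * q) = L (π n * π n) := by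
  have : (q - π n).degree < (n : WithBot ℕ) := by
    rw [← hqd]
    exact degree_sub_lt_left (by rw [hqd, h.degree_eq]) hq.ne_zero (by rw [hq, hm n])
  have h0 := h.orth n _ this
  rw [mul_sub, map_sub] at h0
  linarith

theorem zero_eq_one (h : OrthoSeq L π) (hm : ∀ n, (π n).Monic) : π 0 = 1 :=
  (hm 0).natDegree_eq_zero.1 (h.natDegree_eq 0)

/-- Moving X to the other factor shows that Xπ_{n+1} is orthogonal to degrees below n. The
coefficient of π_n comes from pairing π_{n+1} with the monic polynomial Xπ_n of the same degree; its
explicit form shows that it is positive. -/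
theorem recurrence (h : OrthoSeq L π) (hL : PosFunctional L) (hm : ∀ n, (π n).Monic) (n : ℕ) :
    ∃ b : ℝ, π (n + 2) = (X - C b) * π (n + 1)
      - C (L (π (n + 1) * π (n + 1)) / L (π n * π n)) * π n := by
  have hd : (X * π (n + 1)).degree = ((n + 2 : ℕ) : WithBot ℕ) := by
    rw [degree_mul, degree_X, h.degree_eq]; push_cast; ring
  have hXm : ∀ k, (X * π k).Monic := fun k => monic_X.mul (hm k)
  have key := h.expand_add_two hL (m := n) (f := X * π (n + 1))
    (by rw [hd]; exact_mod_cast Nat.lt_succ_self _) (by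
      intro q hq
      rw [mul_comm X, mul_assoc]
      refine h.orth _ _ ?_
      rw [degree_mul, degree_X]
      rcases eq_or_ne q 0 with rfl | hq0
      · simp
      · rw [degree_eq_natDegree hq0] at hq ⊢
        have : q.natDegree < n := by exact_mod_cast hq
        have h2 : 1 + q.natDegree < n + 1 := by omega
        exact_mod_cast h2)
  have e1 : L (X * π (n + 1) * π (n + 2)) = L (π (n + 2) * π (n + 2)) := by
    rw [mul_comm (X * _)]; exact h.apply_mul_monic hm (hXm _) hd
  have e2 : L (X * π (n + 1) * π n) = L (π (n + 1) * π (n + 1)) := by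
    rw [show X * π (n + 1) * π n = π (n + 1) * (X * π n) by ring]
    refine h.apply_mul_monic hm (hXm _) ?_
    rw [degree_mul, degree_X, h.degree_eq]; push_cast; ring
  rw [e1, e2, div_self (h.sq_pos hL _).ne', C_1, one_mul] at key
  refine ⟨L (X * π (n + 1) * π (n + 1)) / L (π (n + 1) * π (n + 1)), ?_⟩
  linear_combination -key

theorem exists_one (h : OrthoSeq L π) (hm : ∀ n, (π n).Monic) : ∃ b : ℝ, π 1 = X - C b := by
  have h1 := (hm 1).eq_X_add_C (h.natDegree_eq 1)
  exact ⟨-(π 1).coeff 0, by rw [h1]; simp⟩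

/-- The Wronskian of consecutive orthogonal polynomials is positive. -/
theorem wronskian_pos (h : OrthoSeq L π) (hL : PosFunctional L) (hm : ∀ n, (π n).Monic)
    (n : ℕ) (x : ℝ) :
    0 < (derivative (π (n + 1))).eval x * (π n).eval x
      - (π (n + 1)).eval x * (derivative (π n)).eval x := by
  induction n with
  | zero =>
    obtain ⟨b, hb⟩ := h.exists_one hm
    rw [zero_add, hb, h.zero_eq_one hm]
    simp
  | succ n ih =>
    obtain ⟨b, hb⟩ := h.recurrence hL hm n
    have ha : 0 < L (π (n + 1) * π (n + 1)) / L (π n * π n) :=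
      div_pos (h.sq_pos hL _) (h.sq_pos hL _)
    set a := L (π (n + 1) * π (n + 1)) / L (π n * π n)
    rw [hb]
    simp only [derivative_sub, derivative_mul, derivative_X, derivative_C, eval_sub, eval_mul,
      eval_add, eval_X, eval_C, eval_one, eval_zero]
    -- With W_n the Wronskian and a the recurrence coefficient, W_{n+1} = π_{n+1}² + a W_n.
    have := mul_pos ha ih
    nlinarith [mul_self_nonneg ((π (n + 1)).eval x)]

/-! ### Zeros -/

/-- If π_n = q g, then L(q g²) = L(π_n g) = 0 because deg g < n, although q g² ≥ 0 on (1, ∞). The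
choices q = X - r with r ≤ 1, q = (X - r)² and q = a real quadratic with non-real roots show that
the zeros are greater than 1, simple and real. -/
theorem not_dvd_of_nonneg (h : OrthoSeq L π) (hL : PosFunctional L) {n : ℕ} {q : ℝ[X]}
    (hq : 0 < q.degree) (hpos : ∀ x, 1 < x → 0 ≤ q.eval x) : ¬ q ∣ π n := by
  rintro ⟨g, hg⟩
  have hg0 : g ≠ 0 := by
    rintro rfl
    exact h.ne_zero n (by rw [hg, mul_zero])
  have hq0 : q ≠ 0 := by
    rintro rfl
    simp at hq
  have hd : g.degree < (n : WithBot ℕ) := by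
    have := h.natDegree_eq n
    rw [hg, natDegree_mul hq0 hg0] at this
    rw [degree_eq_natDegree hg0]
    have := natDegree_pos_iff_degree_pos.2 hq
    exact_mod_cast (by omega : g.natDegree < n)
  have h0 := h.orth n g hd
  have := hL (q * (g * g)) (mul_ne_zero hq0 (mul_ne_zero hg0 hg0)) fun x hx => by
    rw [eval_mul, eval_mul]; exact mul_nonneg (hpos x hx) (mul_self_nonneg _)
  rw [hg, mul_assoc] at h0
  linarith

theorem one_lt_of_isRoot (h : OrthoSeq L π) (hL : PosFunctional L) {n : ℕ} {r : ℝ}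
    (hr : (π n).eval r = 0) : 1 < r := by
  by_contra hle
  refine h.not_dvd_of_nonneg hL (q := X - C r) (by rw [degree_X_sub_C]; exact zero_lt_one) ?_
    (dvd_iff_isRoot.2 hr)
  intro x hx
  simp only [eval_sub, eval_X, eval_C]
  linarith

theorem nodup_roots (h : OrthoSeq L π) (hL : PosFunctional L) (n : ℕ) : (π n).roots.Nodup := by
  rw [Multiset.nodup_iff_count_le_one]
  intro r
  rw [count_roots]
  by_contra hlt
  push Not at hlt
  have := (pow_dvd_pow _ hlt).trans (pow_rootMultiplicity_dvd (π n) r)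
  refine h.not_dvd_of_nonneg hL ?_ ?_ this
  · rw [degree_pow, degree_X_sub_C]; decide
  · intro x _
    simpa using sq_nonneg (x - r)

theorem splits (h : OrthoSeq L π) (hL : PosFunctional L) (n : ℕ) : (π n).Splits := by
  refine Splits.of_splits_map_of_injective (i := algebraMap ℝ ℂ) (algebraMap ℝ ℂ).injective
    (IsAlgClosed.splits _) ?_
  intro z hz
  have hz0 : aeval z (π n) = 0 := by
    rw [aeval_def, ← eval_map]
    exact (mem_roots'.1 hz).2
  by_cases him : z.im = 0
  · exact ⟨z.re, by apply Complex.ext <;> simp [him]⟩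
  · exfalso
    refine h.not_dvd_of_nonneg hL ?_ ?_ (quadratic_dvd_of_aeval_eq_zero_im_ne_zero _ hz0 him)
    · have : (X ^ 2 - C (2 * z.re) * X + C (‖z‖ ^ 2) : ℝ[X]).degree = 2 := by compute_degree!
      rw [this]; decide
    · intro x _
      simp only [eval_add, eval_sub, eval_mul, eval_pow, eval_X, eval_C]
      rw [← Complex.normSq_eq_norm_sq, Complex.normSq_apply]
      nlinarith [mul_self_nonneg (x - z.re), mul_self_nonneg z.im]

theorem eq_prod (h : OrthoSeq L π) (hL : PosFunctional L) (hm : ∀ n, (π n).Monic) (n : ℕ) :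
    π n = Lagrange.nodal (π n).roots.toFinset id := by
  rw [Lagrange.nodal_eq]
  conv_lhs => rw [(h.splits hL n).eq_prod_roots_of_monic (hm n)]
  rw [Finset.prod, Multiset.toFinset_val, (h.nodup_roots hL n).dedup]
  rfl

theorem card_roots (h : OrthoSeq L π) (hL : PosFunctional L) (n : ℕ) :
    (π n).roots.toFinset.card = n := by
  rw [Multiset.toFinset_card_of_nodup (h.nodup_roots hL n),
    ← (h.splits hL n).natDegree_eq_card_roots, h.natDegree_eq]

end OrthoSeq

end RelOP

namespace RelOP

open MeasureTheory Set Filter Topology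

/-! ### The moment functional -/

/-- The unnormalised weight for `ℓ = 0`. -/
noncomputable def baseWeight (ζ x : ℝ) : ℝ := (x ^ 2 - 1) ^ (-(1 / 2) : ℝ) * Real.exp (-ζ * x)

theorem baseWeight_pos (ζ : ℝ) {x : ℝ} (hx : 1 < x) : 0 < baseWeight ζ x :=
  mul_pos (Real.rpow_pos_of_pos (by nlinarith) _) (Real.exp_pos _)

theorem measurable_baseWeight (ζ : ℝ) : Measurable (baseWeight ζ) := by
  unfold baseWeight
  fun_prop

/-- Comparison with a shifted Gamma integrand: for x > 1, x² - 1 ≥ x - 1 and e^{-ζx} ≤ e^{-ζ(x-1)}.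
Powers of x - 1 rather than of x make the majorant a single Gamma integrand. -/
theorem integrableOn_pow_mul_baseWeight {ζ : ℝ} (hζ : 0 < ζ) (k : ℕ) :
    IntegrableOn (fun x => (x - 1) ^ k * baseWeight ζ x) (Ioi 1) := by
  have h0 : IntegrableOn (fun u : ℝ => u ^ ((k : ℝ) - 1 / 2) * Real.exp (-ζ * u ^ (1 : ℝ)))
      (Ioi 0) :=
    integrableOn_rpow_mul_exp_neg_mul_rpow
      (by have : (0 : ℝ) ≤ k := Nat.cast_nonneg k
          linarith) one_pos hζ
  have h1 : IntegrableOn (fun x : ℝ => (x - 1) ^ ((k : ℝ) - 1 / 2) *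
      Real.exp (-ζ * (x - 1) ^ (1 : ℝ))) (Ioi 1) := by
    have := (integrable_indicator_iff measurableSet_Ioi).2 h0
    have := this.comp_sub_right 1
    rw [← integrable_indicator_iff measurableSet_Ioi]
    refine this.congr (Eventually.of_forall fun x => ?_)
    by_cases hx : 1 < x
    · simp [indicator, hx]
    · simp [indicator, hx]
  refine Integrable.mono' h1 ?_ ?_
  · exact (((measurable_id.sub_const 1).pow_const k).mul
      (measurable_baseWeight ζ)).aestronglyMeasurable
  · filter_upwards [ae_restrict_mem measurableSet_Ioi] with x hx
    have hx : 1 < x := hx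
    have hx0 : 0 < x - 1 := by linarith
    rw [Real.norm_of_nonneg (mul_nonneg (by positivity) (baseWeight_pos ζ hx).le), baseWeight,
      ← mul_assoc, Real.rpow_one]
    refine mul_le_mul ?_ (Real.exp_le_exp.2 (by nlinarith)) (Real.exp_pos _).le (by positivity)
    rw [sub_eq_add_neg (k : ℝ), Real.rpow_add hx0, Real.rpow_natCast]
    refine mul_le_mul_of_nonneg_left ?_ (by positivity)
    exact Real.rpow_le_rpow_of_nonpos hx0 (by nlinarith) (by norm_num)

theorem integrableOn_eval_mul_baseWeight {ζ : ℝ} (hζ : 0 < ζ) (p : ℝ[X]) :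
    IntegrableOn (fun x => p.eval x * baseWeight ζ x) (Ioi 1) := by
  have hp : ∀ x : ℝ, p.eval x * baseWeight ζ x =
      ∑ k ∈ Finset.range ((p.comp (X + 1)).natDegree + 1),
        (p.comp (X + 1)).coeff k * ((x - 1) ^ k * baseWeight ζ x) := by
    intro x
    have : p.eval x = (p.comp (X + 1)).eval (x - 1) := by simp
    rw [this, eval_eq_sum_range, Finset.sum_mul]
    exact Finset.sum_congr rfl fun k _ => by ring
  simp_rw [hp]
  exact integrable_finsetSum _ fun k _ => (integrableOn_pow_mul_baseWeight hζ k).const_mul _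

open Classical in
/-- The unnormalised moment functional for `ℓ = 0`. -/
noncomputable def mom (ζ : ℝ) : ℝ[X] →ₗ[ℝ] ℝ :=
  -- Additivity rests on integrability, which is proved for `0 < ζ`; the zero functional elsewhere
  -- is a default.
  if hζ : 0 < ζ then
    { toFun := fun p => ∫ x in Ioi (1 : ℝ), p.eval x * baseWeight ζ x
      map_add' := fun p q => by
        rw [← integral_add (integrableOn_eval_mul_baseWeight hζ p)
          (integrableOn_eval_mul_baseWeight hζ q)]
        simp only [eval_add, add_mul]
      map_smul' := fun c p => by
        rw [RingHom.id_apply, smul_eq_mul, ← integral_const_mul]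
        simp only [eval_smul, smul_eq_mul, mul_assoc] }
  else 0

theorem mom_apply {ζ : ℝ} (hζ : 0 < ζ) (p : ℝ[X]) :
    mom ζ p = ∫ x in Ioi (1 : ℝ), p.eval x * baseWeight ζ x := by
  rw [mom, dif_pos hζ]; rfl

theorem posFunctional_mom {ζ : ℝ} (hζ : 0 < ζ) : PosFunctional (mom ζ) := by
  intro p hp hpos
  rw [mom_apply hζ]
  have hnn : 0 ≤ᵐ[volume.restrict (Ioi (1 : ℝ))] fun x => p.eval x * baseWeight ζ x := by
    filter_upwards [ae_restrict_mem measurableSet_Ioi] with x hx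
    exact mul_nonneg (hpos x hx) (baseWeight_pos ζ hx).le
  rw [setIntegral_pos_iff_support_of_nonneg_ae hnn (integrableOn_eval_mul_baseWeight hζ p)]
  -- The integrand can vanish only at the finitely many roots of `p`, a null set.
  have hsub : Ioi (1 : ℝ) \ (p.roots.toFinset : Set ℝ) ⊆
      (Function.support fun x => p.eval x * baseWeight ζ x) ∩ Ioi 1 := by
    rintro x ⟨hx, hxr⟩
    refine ⟨?_, hx⟩
    have : p.eval x ≠ 0 := by
      intro h0
      exact hxr (by simp [hp, h0])
    exact mul_ne_zero this (baseWeight_pos ζ hx).ne'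
  refine lt_of_lt_of_le ?_ (measure_mono hsub)
  rw [measure_sdiff_null (Finset.measure_zero _ _), Real.volume_Ioi]
  exact ENNReal.zero_lt_top

theorem hasDerivAt_mom {ζ : ℝ} (hζ : 0 < ζ) (p : ℝ[X]) :
    HasDerivAt (fun s => mom s p) (-mom ζ (X * p)) ζ := by
  -- On this interval the weight at `ζ / 2` dominates, since e^{-sx} decreases in s.
  have hs : Ioo (ζ / 2) (2 * ζ) ∈ 𝓝 ζ := Ioo_mem_nhds (by linarith) (by linarith)
  have key := (hasDerivAt_integral_of_dominated_loc_of_deriv_le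
    (μ := volume.restrict (Ioi (1 : ℝ))) (F := fun s x => p.eval x * baseWeight s x)
    (F' := fun s x => -((X * p).eval x * baseWeight s x)) (x₀ := ζ)
    (bound := fun x => ‖(X * p).eval x * baseWeight (ζ / 2) x‖) hs
    (Eventually.of_forall fun s =>
      (p.continuous.measurable.mul (measurable_baseWeight s)).aestronglyMeasurable)
    (integrableOn_eval_mul_baseWeight hζ p)
    (((X * p).continuous.measurable.mul (measurable_baseWeight ζ)).neg.aestronglyMeasurable)
    ?_ (integrableOn_eval_mul_baseWeight (half_pos hζ) (X * p)).norm ?_).2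
  · rw [integral_neg, ← mom_apply hζ] at key
    refine key.congr_of_eventuallyEq ?_
    filter_upwards [lt_mem_nhds hζ] with s hs
    exact mom_apply hs p
  · filter_upwards [ae_restrict_mem measurableSet_Ioi] with x hx s hs
    have hx : 1 < x := hx
    rw [norm_neg, norm_mul, norm_mul]
    refine mul_le_mul_of_nonneg_left ?_ (norm_nonneg _)
    rw [Real.norm_of_nonneg (baseWeight_pos _ hx).le, Real.norm_of_nonneg (baseWeight_pos _ hx).le]
    refine mul_le_mul_of_nonneg_left (Real.exp_le_exp.2 ?_)
      (Real.rpow_nonneg (by nlinarith) _)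
    nlinarith [hs.1]
  · refine Eventually.of_forall fun x s _ => ?_
    have h1 : HasDerivAt (fun s : ℝ => Real.exp (-s * x)) (Real.exp (-s * x) * (-1 * x)) s :=
      (((hasDerivAt_id s).neg).mul_const x).exp
    have h2 := (h1.const_mul ((x ^ 2 - 1) ^ (-(1 / 2) : ℝ))).const_mul (p.eval x)
    refine h2.congr_deriv ?_
    simp only [baseWeight, eval_mul, eval_X]
    ring

/-- K_1 enters only as a normalising factor, so its positivity is all that is used. -/
theorem besselK_one_pos {ζ : ℝ} (hζ : 0 < ζ) : 0 < besselK 1 ζ := by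
  have hpos : ∀ θ : ℝ, 0 < Real.cosh (1 * θ) * Real.exp (-ζ * Real.cosh θ) := fun θ =>
    mul_pos (Real.cosh_pos _) (Real.exp_pos _)
  have hint : IntegrableOn (fun θ => Real.cosh (1 * θ) * Real.exp (-ζ * Real.cosh θ))
      (Ioi (0 : ℝ)) := by
    refine Integrable.mono' ((exp_neg_integrableOn_Ioi 0 (half_pos hζ)).const_mul (2 / ζ))
      (by fun_prop) ?_
    filter_upwards [ae_restrict_mem measurableSet_Ioi] with θ hθ
    have hθ : 0 < θ := hθ
    rw [Real.norm_of_nonneg (hpos θ).le, one_mul]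
    set y := Real.cosh θ
    have hy : θ ≤ y :=
      (Real.self_le_sinh_iff.2 hθ.le).trans (Real.sinh_lt_cosh θ).le
    -- Half of the exponential decay absorbs the factor cosh θ; the other half stays integrable
    -- because cosh θ ≥ θ.
    have h1 : y ≤ 2 / ζ * Real.exp (ζ / 2 * y) := by
      have := Real.add_one_le_exp (ζ / 2 * y)
      have h2 : ζ / 2 * y ≤ Real.exp (ζ / 2 * y) := by linarith
      calc y = 2 / ζ * (ζ / 2 * y) := by field_simp
        _ ≤ _ := mul_le_mul_of_nonneg_left h2 (by positivity)
    calc y * Real.exp (-ζ * y) ≤ 2 / ζ * Real.exp (ζ / 2 * y) * Real.exp (-ζ * y) :=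
          mul_le_mul_of_nonneg_right h1 (Real.exp_pos _).le
      _ = 2 / ζ * Real.exp (-(ζ / 2) * y) := by
          rw [mul_assoc, ← Real.exp_add]; ring_nf
      _ ≤ 2 / ζ * Real.exp (-(ζ / 2) * θ) :=
          mul_le_mul_of_nonneg_left (Real.exp_le_exp.2 (by nlinarith)) (by positivity)
  rw [besselK, setIntegral_pos_iff_support_of_nonneg_ae (Eventually.of_forall fun θ => (hpos θ).le)
    hint]
  have : (Function.support fun θ => Real.cosh (1 * θ) * Real.exp (-ζ * Real.cosh θ)) = univ :=
    eq_univ_of_forall fun θ => (hpos θ).ne'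
  rw [this, univ_inter, Real.volume_Ioi]
  exact ENNReal.zero_lt_top

/-- The functional `p ↦ ∫ p ω^(ℓ)`. -/
noncomputable def wmom (l : ℕ) (ζ : ℝ) : ℝ[X] →ₗ[ℝ] ℝ :=
  (besselK 1 ζ)⁻¹ • (mom ζ ∘ₗ LinearMap.mulLeft ℝ ((X ^ 2 - 1) ^ l))

theorem wmom_apply (l : ℕ) (ζ : ℝ) (p : ℝ[X]) :
    wmom l ζ p = (besselK 1 ζ)⁻¹ * mom ζ ((X ^ 2 - 1) ^ l * p) := rfl

/-- The link between the two families: their weights differ by the factor x² - 1. -/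
theorem wmom_one (ζ : ℝ) (p : ℝ[X]) : wmom 1 ζ p = wmom 0 ζ ((X ^ 2 - 1) * p) := by
  simp [wmom_apply]

theorem X_sq_sub_one_ne_zero : (X ^ 2 - 1 : ℝ[X]) ≠ 0 :=
  (monic_X_pow_sub_C (1 : ℝ) two_ne_zero).ne_zero

theorem posFunctional_wmom (l : ℕ) {ζ : ℝ} (hζ : 0 < ζ) : PosFunctional (wmom l ζ) := by
  intro p hp hpos
  rw [wmom_apply]
  refine mul_pos (inv_pos.2 (besselK_one_pos hζ)) (posFunctional_mom hζ _
    (mul_ne_zero (pow_ne_zero _ X_sq_sub_one_ne_zero) hp) fun x hx => ?_)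
  rw [eval_mul]
  refine mul_nonneg ?_ (hpos x hx)
  simp only [eval_pow, eval_sub, eval_X, eval_one]
  exact pow_nonneg (by nlinarith) _

theorem ip_eq (l : ℕ) {ζ : ℝ} (hζ : 0 < ζ) (f g : ℝ[X]) : ip l ζ f g = wmom l ζ (f * g) := by
  rw [wmom_apply, mom_apply hζ, ip, ← integral_const_mul]
  refine setIntegral_congr_fun measurableSet_Ioi fun x hx => ?_
  have hx : 1 < x := hx
  have hx0 : 0 < x ^ 2 - 1 := by nlinarith
  simp only [weight, baseWeight, eval_mul, eval_pow, eval_sub, eval_X, eval_one]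
  rw [sub_eq_add_neg (l : ℝ), Real.rpow_add hx0, Real.rpow_natCast]
  ring

/-! ### The orthogonal polynomials -/

theorem OrthoSeq.of_pairwise {L : ℝ[X] →ₗ[ℝ] ℝ} {π : ℕ → ℝ[X]}
    (hd : ∀ n : ℕ, (π n).degree = n) (ho : ∀ n : ℕ, ∀ k < n, L (π n * π k) = 0) :
    OrthoSeq L π := by
  refine ⟨hd, fun n => ?_⟩
  have : ∀ m ≤ n, ∀ q : ℝ[X], q.degree < (m : WithBot ℕ) → L (π n * q) = 0 := by
    intro m
    induction m with
    | zero =>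
      intro _ q hq
      have : q = 0 := Polynomial.ext fun k => (degree_lt_iff_coeff_zero q 0).1 hq k (by simp)
      rw [this, mul_zero, map_zero]
    | succ m ih =>
      intro hm q hq
      have hnd : (π m).natDegree = m := natDegree_eq_of_degree_eq_some (hd m)
      have hlc : (π m).coeff m ≠ 0 := by
        have := leadingCoeff_ne_zero.2 (fun h0 : π m = 0 => by simpa [h0] using hd m)
        rwa [leadingCoeff, hnd] at this
      have hg : (q - C (q.coeff m / (π m).coeff m) * π m).degree < (m : WithBot ℕ) := by
        rw [degree_lt_iff_coeff_zero]
        intro k hk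
        rw [coeff_sub, coeff_C_mul]
        rcases hk.eq_or_lt with rfl | hk
        · rw [div_mul_cancel₀ _ hlc, sub_self]
        · rw [(degree_lt_iff_coeff_zero q (m + 1)).1 hq k hk,
            coeff_eq_zero_of_natDegree_lt (p := π m) (n := k) (by rw [hnd]; exact hk)]
          simp
      have h0 := ih (by omega) _ hg
      rw [mul_sub, map_sub, mul_left_comm, ← smul_eq_C_mul, map_smul, ho n m (by omega)] at h0
      simpa using h0
  exact this n le_rfl

theorem monicOP_eq (l : ℕ) {ζ : ℝ} (hζ : 0 < ζ) (n : ℕ) :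
    monicOP l ζ n = X ^ n - ∑ k ∈ Finset.range n,
      C (wmom l ζ (X ^ n * monicOP l ζ k) / wmom l ζ (monicOP l ζ k * monicOP l ζ k))
        * monicOP l ζ k := by
  rw [monicOP, Finset.sum_range]
  simp_rw [ip_eq l hζ]

theorem degree_monicOP (l : ℕ) {ζ : ℝ} (hζ : 0 < ζ) (n : ℕ) :
    (monicOP l ζ n).degree = n ∧ (monicOP l ζ n).Monic := by
  induction n using Nat.strong_induction_on with
  | _ n ih =>
    have hs : (∑ k ∈ Finset.range n,
        C (wmom l ζ (X ^ n * monicOP l ζ k) / wmom l ζ (monicOP l ζ k * monicOP l ζ k))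
        * monicOP l ζ k).degree < (n : WithBot ℕ) := by
      refine mem_degreeLT.1 (Submodule.sum_mem _ fun k hk => mem_degreeLT.2 ?_)
      have hk := Finset.mem_range.1 hk
      rw [← smul_eq_C_mul]
      refine (degree_smul_le _ _).trans_lt ?_
      rw [(ih k hk).1]
      exact_mod_cast hk
    rw [monicOP_eq l hζ]
    constructor
    · rw [degree_sub_eq_left_of_degree_lt (by rw [degree_X_pow]; exact hs), degree_X_pow]
    · exact monic_X_pow_sub hs

theorem monic_monicOP (l : ℕ) {ζ : ℝ} (hζ : 0 < ζ) (n : ℕ) : (monicOP l ζ n).Monic :=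
  (degree_monicOP l hζ n).2

theorem orthoSeq_monicOP (l : ℕ) {ζ : ℝ} (hζ : 0 < ζ) : OrthoSeq (wmom l ζ) (monicOP l ζ) := by
  refine OrthoSeq.of_pairwise (fun n => (degree_monicOP l hζ n).1) fun n => ?_
  induction n using Nat.strong_induction_on with
  | _ n ih =>
    intro k hk
    have hpos : 0 < wmom l ζ (monicOP l ζ k * monicOP l ζ k) := by
      have h0 := (monic_monicOP l hζ k).ne_zero
      refine posFunctional_wmom l hζ _ (mul_ne_zero h0 h0) fun x _ => ?_
      rw [eval_mul]; exact mul_self_nonneg _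
    rw [monicOP_eq l hζ n, sub_mul, map_sub, Finset.sum_mul, map_sum,
      Finset.sum_eq_single_of_mem k (Finset.mem_range.2 hk)]
    · rw [mul_assoc, ← smul_eq_C_mul, map_smul, smul_eq_mul, div_mul_cancel₀ _ hpos.ne', sub_self]
    · intro j hj hjk
      have hj := Finset.mem_range.1 hj
      have : wmom l ζ (monicOP l ζ j * monicOP l ζ k) = 0 := by
        rcases lt_or_gt_of_ne hjk with h | h
        · rw [mul_comm]; exact ih k hk j h
        · exact ih j hj k h
      rw [mul_assoc, ← smul_eq_C_mul, map_smul, this, smul_zero]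

end RelOP

namespace RelOP

open Lagrange

/-! ### Partial fractions with positive residues -/

/-- The quotient `A/B` of two polynomials as a function. -/
noncomputable def quot (A B : ℝ[X]) (x : ℝ) : ℝ := A.eval x / B.eval x

/-- Lagrange interpolation of A at the zeros of the nodal polynomial B, divided by B. The residue
A(ξ)/B'(ξ) has the sign of B'(ξ) A(ξ). -/
theorem exists_partialFractions {s : Finset ℝ} {A : ℝ[X]} (hA : A.degree < s.card)
    (hpos : ∀ ξ ∈ s, 0 < (derivative (nodal s id)).eval ξ * A.eval ξ) :
    ∃ m : ℝ → ℝ, (∀ ξ ∈ s, 0 < m ξ) ∧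
      ∀ x, x ∉ s → quot A (nodal s id) x = ∑ ξ ∈ s, m ξ / (x - ξ) := by
  refine ⟨fun ξ => nodalWeight s id ξ * A.eval ξ, fun ξ hξ => ?_, fun x hx => ?_⟩
  · have h := hpos ξ hξ
    dsimp only
    rw [nodalWeight_eq_eval_derivative_nodal hξ, id]
    have h0 : (derivative (nodal s id)).eval ξ ≠ 0 := left_ne_zero_of_mul h.ne'
    have := div_pos h (mul_self_pos.2 h0)
    rwa [mul_div_mul_left _ _ h0, div_eq_inv_mul] at this
  · have hx' : ∀ i ∈ s, x ≠ id i := fun i hi h => hx (by rw [h]; exact hi)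
    have h1 : A.eval x = (nodal s id).eval x *
        ∑ i ∈ s, nodalWeight s id i * (x - id i)⁻¹ * A.eval (id i) := by
      conv_lhs => rw [eq_interpolate (v := id) (Set.injOn_id _) hA]
      exact eval_interpolate_not_at_node _ hx'
    have h0 : (nodal s id).eval x ≠ 0 := eval_nodal_not_at_node hx'
    rw [quot, h1, mul_div_cancel_left₀ _ h0]
    exact Finset.sum_congr rfl fun ξ _ => by simp only [id]; ring

section PartialFractions

variable {s : Finset ℝ} {m : ℝ → ℝ}

theorem sum_div_neg_lt (hs : s.Nonempty) (h1 : ∀ ξ ∈ s, 1 < ξ) (hm : ∀ ξ ∈ s, 0 < m ξ) {z : ℝ}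
    (hz : 1 < z) : ∑ ξ ∈ s, m ξ / (-1 - ξ) < ∑ ξ ∈ s, m ξ / (-z - ξ) := by
  refine Finset.sum_lt_sum_of_nonempty hs fun ξ hξ => ?_
  have := h1 ξ hξ
  rw [show -1 - ξ = -(1 + ξ) by ring, show -z - ξ = -(z + ξ) by ring, div_neg, div_neg,
    neg_lt_neg_iff]
  exact div_lt_div_of_pos_left (hm ξ hξ) (by linarith) (by linarith)

theorem sum_div_one_lt (hs : s.Nonempty) (h1 : ∀ ξ ∈ s, 1 < ξ) (hm : ∀ ξ ∈ s, 0 < m ξ) :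
    ∑ ξ ∈ s, m ξ / (1 - ξ) < ∑ ξ ∈ s, m ξ / (-1 - ξ) := by
  refine Finset.sum_lt_sum_of_nonempty hs fun ξ hξ => ?_
  have := h1 ξ hξ
  rw [show -1 - ξ = -(1 + ξ) by ring, show 1 - ξ = -(ξ - 1) by ring, div_neg, div_neg,
    neg_lt_neg_iff]
  exact div_lt_div_of_pos_left (hm ξ hξ) (by linarith) (by linarith)

/-- The pole at ξ and its mirror image contribute derivatives of opposite sign, and the former wins
because |z - ξ| < z + ξ. -/
theorem hasDerivAt_sum_div (hs : s.Nonempty) (h1 : ∀ ξ ∈ s, 1 < ξ) (hm : ∀ ξ ∈ s, 0 < m ξ) {z : ℝ}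
    (hz : 0 < z) (hzs : z ∉ s) :
    ∃ d < 0, HasDerivAt (fun x => ∑ ξ ∈ s, m ξ / (x - ξ) + ∑ ξ ∈ s, m ξ / (-x - ξ)) d z := by
  refine ⟨∑ ξ ∈ s, (-(m ξ / (z - ξ) ^ 2) + m ξ / (z + ξ) ^ 2), ?_, ?_⟩
  · refine Finset.sum_neg (fun ξ hξ => ?_) hs
    have hξ1 := h1 ξ hξ
    have hne : z - ξ ≠ 0 := fun h => hzs (by rw [sub_eq_zero.1 h]; exact hξ)
    have : m ξ / (z + ξ) ^ 2 < m ξ / (z - ξ) ^ 2 :=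
      div_lt_div_of_pos_left (hm ξ hξ) (by positivity) (by nlinarith [mul_pos hz (zero_lt_one.trans hξ1)])
    linarith
  · simp_rw [← Finset.sum_add_distrib]
    refine HasDerivAt.fun_sum fun ξ hξ => ?_
    have hξ1 := h1 ξ hξ
    have hne : z - ξ ≠ 0 := fun h => hzs (by rw [sub_eq_zero.1 h]; exact hξ)
    have hne' : -z - ξ ≠ 0 := by
      intro h
      linarith
    have e1 := ((hasDerivAt_id z).sub_const ξ).inv hne |>.const_mul (m ξ)
    have e2 := ((hasDerivAt_id z).neg.sub_const ξ).inv hne' |>.const_mul (m ξ)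
    refine (e1.add e2).congr_deriv ?_
    simp only [id, Pi.neg_apply]
    rw [show (-z - ξ) ^ 2 = (z + ξ) ^ 2 by ring]
    ring

end PartialFractions

theorem eval_nodal_neg_mul_pos {s : Finset ℝ} (h1 : ∀ ξ ∈ s, 1 < ξ) {x y : ℝ} (hx : x ≤ 1)
    (hy : y ≤ 1) : 0 < (nodal s id).eval x * (nodal s id).eval y := by
  rw [eval_nodal, eval_nodal, ← Finset.prod_mul_distrib]
  refine Finset.prod_pos fun ξ hξ => ?_
  have := h1 ξ hξ
  exact mul_pos_of_neg_of_neg (by simp only [id]; linarith) (by simp only [id]; linarith)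

/-- At consecutive nodes the derivative of the nodal polynomial has opposite signs. -/
theorem derivative_nodal_mul_neg {s : Finset ℝ} {a b : ℝ} (ha : a ∈ s) (hb : b ∈ s) (hab : a < b)
    (hgap : ∀ η ∈ s, η ≤ a ∨ b ≤ η) :
    (derivative (nodal s id)).eval a * (derivative (nodal s id)).eval b < 0 := by
  have e1 := eval_nodal_derivative_eval_node_eq (v := (id : ℝ → ℝ)) ha
  have e2 := eval_nodal_derivative_eval_node_eq (v := (id : ℝ → ℝ)) hb
  simp only [id] at e1 e2
  have hba : b ∈ s.erase a := Finset.mem_erase.2 ⟨hab.ne', hb⟩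
  have hab' : a ∈ s.erase b := Finset.mem_erase.2 ⟨hab.ne, ha⟩
  rw [e1, e2, nodal_eq_mul_nodal_erase hba, nodal_eq_mul_nodal_erase hab', Finset.erase_right_comm,
    eval_mul, eval_mul]
  -- No other node lies between `a` and `b`, so every remaining factor has the same sign at both.
  have : 0 < (nodal ((s.erase b).erase a) id).eval a * (nodal ((s.erase b).erase a) id).eval b := by
    rw [eval_nodal, eval_nodal, ← Finset.prod_mul_distrib]
    refine Finset.prod_pos fun η hη => ?_
    simp only [Finset.mem_erase] at hη
    simp only [id]
    rcases hgap η hη.2.2 with h | h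
    · have : η < a := lt_of_le_of_ne h hη.1
      exact mul_pos (by linarith) (by linarith)
    · have : b < η := lt_of_le_of_ne h (Ne.symm hη.2.1)
      exact mul_pos_of_neg_of_neg (by linarith) (by linarith)
  simp only [id, eval_sub, eval_X, eval_C]
  nlinarith [mul_pos (mul_pos (sub_pos.2 hab) (sub_pos.2 hab)) this]

theorem exists_root_between {p : ℝ[X]} {a b : ℝ} (hab : a < b) (h : p.eval a * p.eval b < 0) :
    ∃ c, a < c ∧ c < b ∧ p.eval c = 0 := by
  have hc : ContinuousOn (fun x => p.eval x) (Set.Icc a b) := p.continuous.continuousOn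
  rcases mul_neg_iff.1 h with ⟨h1, h2⟩ | ⟨h1, h2⟩
  · obtain ⟨c, hc, h0⟩ := intermediate_value_Ioo' hab.le hc ⟨h2, h1⟩
    exact ⟨c, hc.1, hc.2, h0⟩
  · obtain ⟨c, hc, h0⟩ := intermediate_value_Ioo hab.le hc ⟨h1, h2⟩
    exact ⟨c, hc.1, hc.2, h0⟩

/-- As many distinct zeros as the degree permits must be all of them, each simple. Serves both for Q
and for the pencil determinant. -/
theorem roots_eq_of_card {p : ℝ[X]} (hp : p ≠ 0) {T : Finset ℝ} (hT : ∀ x ∈ T, p.eval x = 0)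
    (hd : p.natDegree ≤ T.card) : p.roots = T.val ∧ p.natDegree = T.card := by
  have hle : T.val ≤ p.roots :=
    (Multiset.le_iff_subset T.nodup).2 fun x hx => mem_roots'.2 ⟨hp, hT x hx⟩
  have hc : Multiset.card p.roots ≤ p.natDegree := p.card_roots'
  have heq := Multiset.eq_of_le_of_card_le hle (hc.trans hd)
  refine ⟨heq.symm, le_antisymm hd ?_⟩
  rw [Finset.card_def, heq]
  exact hc

/-! ### The zeros of `Q` -/

section Zeros

variable {ζ : ℝ}

/-- The number `S(1) + S(-1)` for `S = A/B`. -/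
noncomputable def symOne (A B : ℝ[X]) : ℝ := quot A B 1 + quot A B (-1)

/-- The polynomial `A(x) B(-x) + A(-x) B(x) - (S(1) + S(-1)) B(x) B(-x)` with `S = A/B`. -/
noncomputable def symPoly (A B : ℝ[X]) : ℝ[X] :=
  A * B.comp (-X) + A.comp (-X) * B - C (symOne A B) * (B * B.comp (-X))

theorem eval_symPoly (A B : ℝ[X]) {x : ℝ} (h1 : B.eval x ≠ 0) (h2 : B.eval (-x) ≠ 0) :
    (symPoly A B).eval x =
      B.eval x * B.eval (-x) * (quot A B x + quot A B (-x) - symOne A B) := by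
  simp only [symPoly, eval_sub, eval_add, eval_mul, eval_comp, eval_neg, eval_X, eval_C]
  rw [quot, quot]
  field_simp

/-- The monic version of `Q`. -/
noncomputable def monicQ (ζ : ℝ) (n : ℕ) : ℝ[X] :=
  monicOP 0 ζ (n + 1) * (monicOP 1 ζ n).comp (-X) + (monicOP 0 ζ (n + 1)).comp (-X) * monicOP 1 ζ n

theorem sqrt_norm_pos (l : ℕ) (hζ : 0 < ζ) (n : ℕ) :
    0 < (Real.sqrt (ip l ζ (monicOP l ζ n) (monicOP l ζ n)))⁻¹ := by
  rw [ip_eq l hζ]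
  exact inv_pos.2 (Real.sqrt_pos.2 ((orthoSeq_monicOP l hζ).sq_pos (posFunctional_wmom l hζ) n))

theorem Q_eq_C_mul (hζ : 0 < ζ) (n : ℕ) : ∃ c : ℝ, 0 < c ∧ Q ζ n = C c * monicQ ζ n := by
  refine ⟨_, mul_pos (sqrt_norm_pos 0 hζ (n + 1)) (sqrt_norm_pos 1 hζ n), ?_⟩
  rw [Q, monicQ, P, P, C_mul]
  simp only [mul_comp, C_comp]
  ring

/-- By `wmom_one` the left side is orthogonal for ℓ = 0 to degrees below n, so it involves only the
indices n, n + 1, n + 2; the recurrence eliminates the last. -/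
theorem exists_christoffel (hζ : 0 < ζ) (n : ℕ) : ∃ α δ : ℝ, α ≠ 0 ∧
    (X ^ 2 - 1) * monicOP 1 ζ n = C α * monicOP 0 ζ n + (X + C δ) * monicOP 0 ζ (n + 1) := by
  have h0 := orthoSeq_monicOP 0 hζ
  have hL := posFunctional_wmom 0 hζ
  have h1 := orthoSeq_monicOP 1 hζ
  have hm := monic_monicOP 0 hζ
  have hm1 := monic_monicOP 1 hζ n
  have hsq : (X ^ 2 - 1 : ℝ[X]).Monic := monic_X_pow_sub_C (1 : ℝ) two_ne_zero
  have hsqd : (X ^ 2 - 1 : ℝ[X]).degree = 2 := degree_X_pow_sub_C two_pos 1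
  have hd : ((X ^ 2 - 1) * monicOP 1 ζ n).degree = ((n + 2 : ℕ) : WithBot ℕ) := by
    rw [degree_mul, hsqd, h1.degree_eq]; push_cast; ring
  have key := h0.expand_add_two hL (m := n) (f := (X ^ 2 - 1) * monicOP 1 ζ n)
    (by rw [hd]; exact_mod_cast Nat.lt_succ_self _) (by
      intro q hq
      rw [mul_assoc, ← wmom_one]
      exact h1.orth _ _ hq)
  rw [mul_comm (_ * _) (monicOP 0 ζ (n + 2)), h0.apply_mul_monic hm (hsq.mul hm1) hd,
    div_self (h0.sq_pos hL _).ne', C_1, one_mul] at key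
  obtain ⟨b, hb⟩ := h0.recurrence hL hm n
  set α := wmom 0 ζ ((X ^ 2 - 1) * monicOP 1 ζ n * monicOP 0 ζ n) /
      wmom 0 ζ (monicOP 0 ζ n * monicOP 0 ζ n) -
      wmom 0 ζ (monicOP 0 ζ (n + 1) * monicOP 0 ζ (n + 1)) /
      wmom 0 ζ (monicOP 0 ζ n * monicOP 0 ζ n) with hα
  set e := wmom 0 ζ ((X ^ 2 - 1) * monicOP 1 ζ n * monicOP 0 ζ (n + 1)) /
      wmom 0 ζ (monicOP 0 ζ (n + 1) * monicOP 0 ζ (n + 1)) with he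
  have hrel : (X ^ 2 - 1) * monicOP 1 ζ n =
      C α * monicOP 0 ζ n + (X + C (e - b)) * monicOP 0 ζ (n + 1) := by
    rw [key, hb, hα, C_sub, C_sub]
    ring
  refine ⟨α, e - b, ?_, hrel⟩
  -- If α were 0, the left side vanishing at ±1 would force both δ = -1 and δ = 1, as the polynomial
  -- of index n + 1 has no zero at ±1.
  intro h
  rw [h] at hrel
  have hB : ∀ x : ℝ, x ≤ 1 → (monicOP 0 ζ (n + 1)).eval x ≠ 0 := fun x hx h0' =>
    absurd (h0.one_lt_of_isRoot hL h0') (not_lt.2 hx)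
  have p1 := congrArg (eval 1) hrel
  have p2 := congrArg (eval (-1)) hrel
  simp only [eval_mul, eval_add, eval_sub, eval_pow, eval_X, eval_C, eval_one] at p1 p2
  have q1 := (mul_eq_zero.1 (show (1 + (e - b)) * _ = 0 by linarith)).resolve_right (hB 1 le_rfl)
  have q2 := (mul_eq_zero.1 (show (-1 + (e - b)) * _ = 0 by linarith)).resolve_right
    (hB (-1) (by norm_num))
  linarith

theorem eval_monicOP_ne_zero (l : ℕ) (hζ : 0 < ζ) (n : ℕ) {x : ℝ} (hx : x ≤ 1) :
    (monicOP l ζ n).eval x ≠ 0 := fun h =>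
  absurd ((orthoSeq_monicOP l hζ).one_lt_of_isRoot (posFunctional_wmom l hζ) h) (not_lt.2 hx)

/-- `(x² - 1) Q(x)` in terms of the polynomials for `ℓ = 0` only. -/
theorem exists_mul_monicQ (hζ : 0 < ζ) (n : ℕ) : ∃ α : ℝ, α ≠ 0 ∧
    (X ^ 2 - 1) * monicQ ζ n = C α * symPoly (monicOP 0 ζ n) (monicOP 0 ζ (n + 1)) := by
  obtain ⟨α, δ, hα, h⟩ := exists_christoffel hζ n
  refine ⟨α, hα, ?_⟩
  have hB1 := eval_monicOP_ne_zero 0 hζ (n + 1) (le_refl (1 : ℝ))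
  have hB2 := eval_monicOP_ne_zero 0 hζ (n + 1) (show (-1 : ℝ) ≤ 1 by norm_num)
  have p1 := congrArg (eval 1) h
  have p2 := congrArg (eval (-1)) h
  simp only [eval_mul, eval_add, eval_sub, eval_pow, eval_X, eval_C, eval_one] at p1 p2
  -- Evaluation of the relation at ±1 expresses δ through S(1) + S(-1).
  have hδ : α * symOne (monicOP 0 ζ n) (monicOP 0 ζ (n + 1)) = -(2 * δ) := by
    have e1 : α * quot (monicOP 0 ζ n) (monicOP 0 ζ (n + 1)) 1 = -(1 + δ) := by
      rw [quot]; field_simp; linarith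
    have e2 : α * quot (monicOP 0 ζ n) (monicOP 0 ζ (n + 1)) (-1) = -(-1 + δ) := by
      rw [quot]; field_simp; linarith
    rw [symOne, mul_add, e1, e2]; ring
  have h' := congrArg (fun p => p.comp (-X)) h
  simp only [mul_comp, add_comp, sub_comp, pow_comp, X_comp, C_comp, one_comp] at h'
  have hC : C α * C (symOne (monicOP 0 ζ n) (monicOP 0 ζ (n + 1))) = -(2 * C δ) := by
    rw [← C_mul, hδ, C_neg, C_mul]; rfl
  rw [monicQ, symPoly]
  -- The linear factors x + δ and -x + δ add up to 2δ, so only a constant multiple of B(x) B(-x) is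
  -- left.
  linear_combination (monicOP 0 ζ (n + 1)) * h' + (monicOP 0 ζ (n + 1)).comp (-X) * h
    + (monicOP 0 ζ (n + 1)) * (monicOP 0 ζ (n + 1)).comp (-X) * hC

theorem monicQ_comp_neg (ζ : ℝ) (n : ℕ) : (monicQ ζ n).comp (-X) = monicQ ζ n := by
  rw [monicQ]
  simp only [add_comp, mul_comp, comp_neg_X_comp_neg_X]
  ring

theorem eval_neg_monicQ (ζ : ℝ) (n : ℕ) (x : ℝ) :
    (monicQ ζ n).eval (-x) = (monicQ ζ n).eval x := by
  conv_rhs => rw [← monicQ_comp_neg]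
  simp

theorem coeff_comp_neg_X (p : ℝ[X]) (k : ℕ) : (p.comp (-X)).coeff k = p.coeff k * (-1) ^ k := by
  rw [← comp_C_mul_X_coeff]
  simp

/-- The factors allow degree 2n + 1, but evenness kills that coefficient. Equality follows later by
counting zeros. -/
theorem natDegree_monicQ_le (hζ : 0 < ζ) (n : ℕ) : (monicQ ζ n).natDegree ≤ 2 * n := by
  have hle : (monicQ ζ n).natDegree ≤ 2 * n + 1 := by
    rw [monicQ]
    refine (natDegree_add_le _ _).trans (max_le ?_ ?_) <;>
    · refine natDegree_mul_le.trans ?_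
      have h1 := (orthoSeq_monicOP 0 hζ).natDegree_eq (n + 1)
      have h2 := (orthoSeq_monicOP 1 hζ).natDegree_eq n
      simp only [natDegree_comp, natDegree_neg, natDegree_X, h1, h2]
      omega
  refine natDegree_le_iff_coeff_eq_zero.2 fun N hN => ?_
  rcases (show 2 * n + 1 ≤ N from hN).eq_or_lt with rfl | hN
  · have h := congrArg (fun p => p.coeff (2 * n + 1)) (monicQ_comp_neg ζ n)
    simp only [coeff_comp_neg_X] at h
    rw [pow_succ, pow_mul] at h
    norm_num at h
    linarith
  · exact coeff_eq_zero_of_natDegree_lt (hle.trans_lt hN)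

theorem monicQ_ne_zero (hζ : 0 < ζ) (n : ℕ) : monicQ ζ n ≠ 0 := by
  intro h
  have h0 := congrArg (eval 0) h
  have h1 := eval_monicOP_ne_zero 0 hζ (n + 1) (zero_le_one (α := ℝ))
  have h2 := eval_monicOP_ne_zero 1 hζ n (zero_le_one (α := ℝ))
  simp only [monicQ, eval_add, eval_mul, eval_comp, eval_neg, eval_X, neg_zero, eval_zero] at h0
  exact mul_ne_zero h1 h2 (by linarith)

/-- `monicQ` has `n` zeros in `(1, ∞)`. -/
theorem exists_pos_roots (hζ : 0 < ζ) (n : ℕ) :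
    ∃ R : Finset ℝ, R.card = n ∧ ∀ x ∈ R, 1 < x ∧ (monicQ ζ n).eval x = 0 := by
  have h0 := orthoSeq_monicOP 0 hζ
  have hL := posFunctional_wmom 0 hζ
  have hm := monic_monicOP 0 hζ
  obtain ⟨α, hα, hQ⟩ := exists_mul_monicQ hζ n
  set s := (monicOP 0 ζ (n + 1)).roots.toFinset with hs
  have hcard : s.card = n + 1 := h0.card_roots hL (n + 1)
  have hB : monicOP 0 ζ (n + 1) = nodal s id := h0.eq_prod hL hm (n + 1)
  have hroot : ∀ ξ ∈ s, (monicOP 0 ζ (n + 1)).eval ξ = 0 := fun ξ hξ =>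
    (mem_roots'.1 (Multiset.mem_toFinset.1 hξ)).2
  have h1 : ∀ ξ ∈ s, 1 < ξ := fun ξ hξ => h0.one_lt_of_isRoot hL (hroot ξ hξ)
  -- At a zero of B only the term A(ξ) B(-ξ) of `symPoly` survives.
  have hev : ∀ ξ ∈ s, (ξ ^ 2 - 1) * (monicQ ζ n).eval ξ =
      α * ((monicOP 0 ζ n).eval ξ * (nodal s id).eval (-ξ)) := by
    intro ξ hξ
    have := congrArg (eval ξ) hQ
    simp only [symPoly, eval_mul, eval_add, eval_sub, eval_pow, eval_X, eval_C, eval_one,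
      eval_comp, eval_neg, hroot ξ hξ] at this
    rw [this, ← hB]; ring
  have hW : ∀ ξ ∈ s, 0 < (derivative (nodal s id)).eval ξ * (monicOP 0 ζ n).eval ξ := by
    intro ξ hξ
    have := h0.wronskian_pos hL hm n ξ
    rwa [hroot ξ hξ, zero_mul, sub_zero, hB] at this
  have hgap : ∀ i : Fin n, ∃ c, s.orderEmbOfFin hcard i.castSucc < c ∧
      c < s.orderEmbOfFin hcard i.succ ∧ (monicQ ζ n).eval c = 0 := by
    intro i
    set a := s.orderEmbOfFin hcard i.castSucc with ha
    set b := s.orderEmbOfFin hcard i.succ with hb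
    have hab : a < b := (s.orderEmbOfFin hcard).strictMono (Fin.castSucc_lt_succ)
    have has : a ∈ s := s.orderEmbOfFin_mem hcard _
    have hbs : b ∈ s := s.orderEmbOfFin_mem hcard _
    refine exists_root_between hab ?_
    have hd := derivative_nodal_mul_neg has hbs hab (by
      intro η hη
      obtain ⟨j, rfl⟩ : ∃ j, s.orderEmbOfFin hcard j = η := by
        have : η ∈ Set.range (s.orderEmbOfFin hcard) := by
          rw [Finset.range_orderEmbOfFin]; exact hη
        exact this
      rw [ha, hb, (s.orderEmbOfFin hcard).le_iff_le, (s.orderEmbOfFin hcard).le_iff_le]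
      rcases le_or_gt j i.castSucc with h | h
      · exact Or.inl h
      · exact Or.inr (Fin.castSucc_lt_iff_succ_le.1 h))
    -- By the Wronskian A has the sign of B' at the zeros of B, and B' alternates there.
    have hA : (monicOP 0 ζ n).eval a * (monicOP 0 ζ n).eval b < 0 := by
      have := mul_pos (hW a has) (hW b hbs)
      by_contra hcon
      push Not at hcon
      nlinarith
    have hN := eval_nodal_neg_mul_pos h1 (x := -a) (y := -b) (by linarith [h1 a has])
      (by linarith [h1 b hbs])
    have hprod : (a ^ 2 - 1) * (b ^ 2 - 1) * ((monicQ ζ n).eval a * (monicQ ζ n).eval b) =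
        α ^ 2 * (((monicOP 0 ζ n).eval a * (monicOP 0 ζ n).eval b) *
          ((nodal s id).eval (-a) * (nodal s id).eval (-b))) := by
      calc _ = ((a ^ 2 - 1) * (monicQ ζ n).eval a) * ((b ^ 2 - 1) * (monicQ ζ n).eval b) := by ring
        _ = _ := by rw [hev a has, hev b hbs]; ring
    have hneg : α ^ 2 * (((monicOP 0 ζ n).eval a * (monicOP 0 ζ n).eval b) *
          ((nodal s id).eval (-a) * (nodal s id).eval (-b))) < 0 :=
      mul_neg_of_pos_of_neg (by positivity) (mul_neg_of_neg_of_pos hA hN)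
    have ha1 := h1 a has
    have hb1 := h1 b hbs
    have hpos : 0 < (a ^ 2 - 1) * (b ^ 2 - 1) := mul_pos (by nlinarith) (by nlinarith)
    rw [← hprod] at hneg
    exact neg_of_mul_neg_right hneg hpos.le
  choose g hg1 hg2 hg3 using hgap
  have hmono : StrictMono g := by
    intro i j hij
    refine (hg2 i).trans (lt_of_le_of_lt ?_ (hg1 j))
    rw [(s.orderEmbOfFin hcard).le_iff_le]
    exact Fin.succ_le_castSucc_iff.2 hij
  refine ⟨Finset.univ.image g, ?_, ?_⟩
  · rw [Finset.card_image_of_injective _ hmono.injective, Finset.card_univ, Fintype.card_fin]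
  · intro x hx
    obtain ⟨i, -, rfl⟩ := Finset.mem_image.1 hx
    exact ⟨(h1 _ (s.orderEmbOfFin_mem hcard _)).trans (hg1 i), hg3 i⟩

end Zeros

end RelOP

namespace RelOP

open Filter Topology Lagrange

/-! ### Families of polynomials depending differentiably on a parameter -/

/-- All coefficients of the family `p` are differentiable at `ζ`. -/
def CoeffDiff (p : ℝ → ℝ[X]) (ζ : ℝ) : Prop :=
  ∀ k, DifferentiableAt ℝ (fun s => (p s).coeff k) ζ

namespace CoeffDiff

variable {p q : ℝ → ℝ[X]} {ζ : ℝ}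

theorem const (f : ℝ[X]) (ζ : ℝ) : CoeffDiff (fun _ => f) ζ := fun _ => differentiableAt_const _

theorem add (hp : CoeffDiff p ζ) (hq : CoeffDiff q ζ) : CoeffDiff (fun s => p s + q s) ζ :=
  fun k => by simpa only [coeff_add] using (hp k).fun_add (hq k)

theorem sub (hp : CoeffDiff p ζ) (hq : CoeffDiff q ζ) : CoeffDiff (fun s => p s - q s) ζ :=
  fun k => by simpa only [coeff_sub] using (hp k).fun_sub (hq k)

theorem mul (hp : CoeffDiff p ζ) (hq : CoeffDiff q ζ) : CoeffDiff (fun s => p s * q s) ζ :=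
  fun k => by
    simp only [coeff_mul]
    exact DifferentiableAt.fun_sum fun i _ => (hp _).mul (hq _)

theorem sum {ι : Type*} {t : Finset ι} {p : ι → ℝ → ℝ[X]} (hp : ∀ i ∈ t, CoeffDiff (p i) ζ) :
    CoeffDiff (fun s => ∑ i ∈ t, p i s) ζ :=
  fun k => by
    simp only [finsetSum_coeff]
    exact DifferentiableAt.fun_sum fun i hi => hp i hi k

theorem C_mul {c : ℝ → ℝ} (hc : DifferentiableAt ℝ c ζ) (hp : CoeffDiff p ζ) :
    CoeffDiff (fun s => C (c s) * p s) ζ :=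
  fun k => by
    simp only [coeff_C_mul]
    exact hc.mul (hp k)

theorem comp_neg_X (hp : CoeffDiff p ζ) : CoeffDiff (fun s => (p s).comp (-X)) ζ :=
  fun k => by
    simp only [coeff_comp_neg_X]
    exact (hp k).mul_const _

theorem congr (hp : CoeffDiff p ζ) (h : ∀ᶠ s in 𝓝 ζ, q s = p s) : CoeffDiff q ζ :=
  fun k => (hp k).congr_of_eventuallyEq (h.mono fun s hs => by simp only [hs])

end CoeffDiff

/-- The derivative of a family of polynomials of degree at most `d`. -/
noncomputable def derivFam (p : ℝ → ℝ[X]) (ζ : ℝ) (d : ℕ) : ℝ[X] :=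
  ∑ k ∈ Finset.range (d + 1), C (deriv (fun s => (p s).coeff k) ζ) * X ^ k

section Family

variable {p : ℝ → ℝ[X]} {ζ : ℝ} {d : ℕ}

theorem CoeffDiff.hasDerivAt_eval (hp : CoeffDiff p ζ) (hd : ∀ᶠ s in 𝓝 ζ, (p s).natDegree ≤ d)
    (x : ℝ) : HasDerivAt (fun s => (p s).eval x) ((derivFam p ζ d).eval x) ζ := by
  have h : HasDerivAt (fun s => ∑ k ∈ Finset.range (d + 1), (p s).coeff k * x ^ k)
      (∑ k ∈ Finset.range (d + 1), deriv (fun s => (p s).coeff k) ζ * x ^ k) ζ :=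
    HasDerivAt.fun_sum fun k _ => (hp k).hasDerivAt.mul_const _
  simp only [derivFam, eval_finsetSum, eval_mul, eval_C, eval_pow, eval_X]
  refine h.congr_of_eventuallyEq (hd.mono fun s hs => ?_)
  exact eval_eq_sum_range' (Nat.lt_succ_of_le hs) x

theorem linear_apply_eq_sum (L : ℝ[X] →ₗ[ℝ] ℝ) {f : ℝ[X]} (hf : f.natDegree ≤ d) (q : ℝ[X]) :
    L (f * q) = ∑ k ∈ Finset.range (d + 1), f.coeff k * L (X ^ k * q) := by
  conv_lhs => rw [as_sum_range_C_mul_X_pow' f (Nat.lt_succ_of_le hf)]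
  rw [Finset.sum_mul, map_sum]
  exact Finset.sum_congr rfl fun k _ => by rw [mul_assoc, ← smul_eq_C_mul, map_smul, smul_eq_mul]

/-- The degree bound near ζ makes the pairing a fixed finite sum of coefficients times moments. The
product rule gives one term from the coefficients and one, with factor -X, from the weight. -/
theorem CoeffDiff.hasDerivAt_mom (hζ : 0 < ζ) (hp : CoeffDiff p ζ)
    (hd : ∀ᶠ s in 𝓝 ζ, (p s).natDegree ≤ d) (q : ℝ[X]) :
    HasDerivAt (fun s => mom s (p s * q)) (mom ζ (derivFam p ζ d * q) - mom ζ (X * p ζ * q)) ζ := by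
  have h : HasDerivAt (fun s => ∑ k ∈ Finset.range (d + 1), (p s).coeff k * mom s (X ^ k * q))
      (∑ k ∈ Finset.range (d + 1), (deriv (fun s => (p s).coeff k) ζ * mom ζ (X ^ k * q)
        + (p ζ).coeff k * -mom ζ (X * (X ^ k * q)))) ζ :=
    HasDerivAt.fun_sum fun k _ => (hp k).hasDerivAt.mul (RelOP.hasDerivAt_mom hζ _)
  refine (h.congr_of_eventuallyEq (hd.mono fun s hs => linear_apply_eq_sum _ hs q)).congr_deriv ?_
  rw [Finset.sum_add_distrib, sub_eq_add_neg]
  congr 1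
  · rw [derivFam, Finset.sum_mul, map_sum]
    exact Finset.sum_congr rfl fun k _ => by
      rw [mul_assoc, ← smul_eq_C_mul, map_smul, smul_eq_mul]
  · rw [show X * p ζ * q = p ζ * (X * q) by ring, linear_apply_eq_sum (mom ζ) hd.self_of_nhds,
      ← Finset.sum_neg_distrib]
    exact Finset.sum_congr rfl fun k _ => by rw [mul_neg, mul_left_comm X]

/-- A zero of a family of polynomials moves differentiably if the derivative there is nonzero. -/
theorem hasDerivAt_zero_of_family {z : ℝ → ℝ} {e f : ℝ} (hd : ∀ᶠ s in 𝓝 ζ, (p s).natDegree ≤ d)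
    (hc : CoeffDiff p ζ) (hz : ContinuousAt z ζ) (hr : ∀ᶠ s in 𝓝 ζ, (p s).eval (z s) = 0)
    (he : HasDerivAt (fun s => (p s).eval (z ζ)) e ζ)
    (hf : (derivative (p ζ)).eval (z ζ) = f) (hf0 : f ≠ 0) : HasDerivAt z (-e / f) ζ := by
  set z0 := z ζ with hz0
  -- `M s` is the divided difference of `p s` between `z0` and `z s`: it is continuous at `ζ`, tends
  -- to the derivative `f`, and `M s * (z s - z0)` equals `-(p s).eval z0`.
  set M : ℝ → ℝ := fun s => ∑ k ∈ Finset.range (d + 1),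
    (p s).coeff k * ∑ i ∈ Finset.range k, z s ^ i * z0 ^ (k - 1 - i) with hM
  have hMc : ContinuousAt M ζ := by
    refine tendsto_finsetSum _ fun k _ => ((hc k).continuousAt).mul ?_
    exact tendsto_finsetSum _ fun i _ => (hz.pow i).mul_const _
  have hMf : M ζ = f := by
    rw [← hf, derivative_eval, sum_over_range' _ (by simp) (d + 1)
      (Nat.lt_succ_of_le hd.self_of_nhds)]
    refine Finset.sum_congr rfl fun k _ => ?_
    rw [mul_assoc]
    congr 1
    rw [← hz0, Finset.sum_congr rfl (g := fun _ => z0 ^ (k - 1))]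
    · simp
    · intro i hi
      have := Finset.mem_range.1 hi
      rw [← pow_add]
      congr 1
      omega
  have hM0 : ∀ᶠ s in 𝓝 ζ, M s ≠ 0 := hMc.eventually_ne (by rw [hMf]; exact hf0)
  have hmul : ∀ᶠ s in 𝓝 ζ, z s = z0 - (p s).eval z0 / M s := by
    filter_upwards [hd, hr, hM0] with s hds hrs hMs
    have h1 : M s * (z s - z0) = (p s).eval (z s) - (p s).eval z0 := by
      rw [eval_eq_sum_range' (Nat.lt_succ_of_le hds), eval_eq_sum_range' (Nat.lt_succ_of_le hds),
        ← Finset.sum_sub_distrib, hM, Finset.sum_mul]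
      exact Finset.sum_congr rfl fun k _ => by rw [mul_assoc, geom_sum₂_mul, mul_sub]
    rw [hrs] at h1
    field_simp
    linarith
  have hE0 : (p ζ).eval z0 = 0 := hr.self_of_nhds
  rw [hasDerivAt_iff_tendsto_slope] at he ⊢
  have hlim : Tendsto (fun s => -slope (fun s => (p s).eval z0) ζ s / M s) (𝓝[≠] ζ)
      (𝓝 (-e / f)) := by
    have := (hMc.tendsto.mono_left nhdsWithin_le_nhds : Tendsto M (𝓝[≠] ζ) _)
    rw [hMf] at this
    exact he.neg.div this hf0
  refine hlim.congr' ?_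
  filter_upwards [nhdsWithin_le_nhds hmul] with s hs
  rw [slope_def_field, slope_def_field, hE0, hs, ← hz0]
  ring

end Family

/-! ### Dependence of the orthogonal polynomials on `ζ` -/

section Toda

variable {ζ : ℝ}

theorem coeffDiff_monicOP (hζ : 0 < ζ) (n : ℕ) : CoeffDiff (fun s => monicOP 0 s n) ζ := by
  induction n using Nat.strong_induction_on with
  | _ n ih =>
    have hpos : ∀ᶠ s in 𝓝 ζ, 0 < s := lt_mem_nhds hζ
    have hdeg : ∀ k, ∀ᶠ s in 𝓝 ζ, (monicOP 0 s k).natDegree ≤ k := fun k =>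
      hpos.mono fun s hs => ((orthoSeq_monicOP 0 hs).natDegree_eq k).le
    have hdeg2 : ∀ k, ∀ᶠ s in 𝓝 ζ, (monicOP 0 s k * monicOP 0 s k).natDegree ≤ k + k := fun k =>
      (hdeg k).mono fun s hs => natDegree_mul_le.trans (add_le_add hs hs)
    -- The factor K_1 cancels in the Gram-Schmidt quotients, so `mom` may replace `wmom`. The
    -- trailing `* 1` gives the denominator the shape that `CoeffDiff.hasDerivAt_mom` expects.
    have hmain : CoeffDiff (fun s => X ^ n - ∑ k ∈ Finset.range n,
        C (mom s (monicOP 0 s k * X ^ n) / mom s (monicOP 0 s k * monicOP 0 s k * 1))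
          * monicOP 0 s k) ζ := by
      refine (CoeffDiff.const _ _).sub (CoeffDiff.sum fun k hk => ?_)
      have hk := ih k (Finset.mem_range.1 hk)
      refine CoeffDiff.C_mul (DifferentiableAt.div ?_ ?_ ?_) hk
      · exact (hk.hasDerivAt_mom hζ (hdeg k) _).differentiableAt
      · exact ((hk.mul hk).hasDerivAt_mom hζ (hdeg2 k) 1).differentiableAt
      · rw [mul_one]
        have h0 := (monic_monicOP 0 hζ k).ne_zero
        refine (posFunctional_mom hζ _ (mul_ne_zero h0 h0) fun x _ => ?_).ne'
        rw [eval_mul]; exact mul_self_nonneg _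
    refine hmain.congr (hpos.mono fun s hs => ?_)
    rw [monicOP_eq 0 hs]
    congr 1
    refine Finset.sum_congr rfl fun k _ => ?_
    rw [wmom_apply, wmom_apply, pow_zero, one_mul, one_mul,
      mul_div_mul_left _ _ (inv_ne_zero (besselK_one_pos hs).ne'), mul_one, mul_comm (X ^ n)]

theorem eventually_natDegree_monicOP (hζ : 0 < ζ) (n : ℕ) :
    ∀ᶠ s in 𝓝 ζ, (monicOP 0 s n).natDegree ≤ n :=
  (lt_mem_nhds hζ).mono fun _ hs => ((orthoSeq_monicOP 0 hs).natDegree_eq n).le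

theorem derivFam_monicOP_degree_lt (hζ : 0 < ζ) (n : ℕ) :
    (derivFam (fun s => monicOP 0 s n) ζ n).degree < (n : WithBot ℕ) := by
  rw [derivFam, Finset.sum_range_succ]
  have h1 : deriv (fun s => (monicOP 0 s n).coeff n) ζ = 0 := by
    have : (fun s => (monicOP 0 s n).coeff n) =ᶠ[𝓝 ζ] fun _ => 1 :=
      (lt_mem_nhds hζ).mono fun s hs => by
        have := monic_monicOP 0 hs n
        rwa [Monic, leadingCoeff, (orthoSeq_monicOP 0 hs).natDegree_eq] at this
    rw [this.deriv_eq, deriv_const]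
  rw [h1, C_0, zero_mul, add_zero]
  refine mem_degreeLT.1 (Submodule.sum_mem _ fun k hk => mem_degreeLT.2 ?_)
  exact (degree_C_mul_X_pow_le _ _).trans_lt (by exact_mod_cast Finset.mem_range.1 hk)

/-- Differentiate the orthogonality of π_n to the fixed polynomial q: the change of π_n must balance
the factor -X coming from the weight. -/
theorem wmom_derivFam (hζ : 0 < ζ) (n : ℕ) {q : ℝ[X]} (hq : q.degree < (n : WithBot ℕ)) :
    wmom 0 ζ (derivFam (fun s => monicOP 0 s n) ζ n * q) = wmom 0 ζ (monicOP 0 ζ n * (X * q)) := by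
  have h := (coeffDiff_monicOP hζ n).hasDerivAt_mom hζ (eventually_natDegree_monicOP hζ n) q
  have h0 : HasDerivAt (fun s => mom s (monicOP 0 s n * q)) 0 ζ := by
    refine (hasDerivAt_const ζ (0 : ℝ)).congr_of_eventuallyEq ?_
    filter_upwards [lt_mem_nhds hζ] with s hs
    have := (orthoSeq_monicOP 0 hs).orth n q hq
    rw [wmom_apply, pow_zero, one_mul] at this
    exact (mul_eq_zero.1 this).resolve_left (inv_ne_zero (besselK_one_pos hs).ne')
  have := h.unique h0
  rw [wmom_apply, wmom_apply, pow_zero, one_mul, one_mul, sub_eq_zero.1 this]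
  congr 2
  ring

/-- The derivative has degree at most n, the leading coefficient being constant. It pairs with π_k
as π_{n+1} does with Xπ_k, which is zero for k < n and the squared norm of π_{n+1} for k = n. -/
theorem derivFam_monicOP_succ (hζ : 0 < ζ) (n : ℕ) :
    derivFam (fun s => monicOP 0 s (n + 1)) ζ (n + 1) =
      C (wmom 0 ζ (monicOP 0 ζ (n + 1) * monicOP 0 ζ (n + 1)) /
        wmom 0 ζ (monicOP 0 ζ n * monicOP 0 ζ n)) * monicOP 0 ζ n := by
  have h := orthoSeq_monicOP 0 hζ
  have hm := monic_monicOP 0 hζ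
  rw [h.expand (posFunctional_wmom 0 hζ) (n + 1) _ (derivFam_monicOP_degree_lt hζ (n + 1)),
    Finset.sum_range_succ, Finset.sum_eq_zero, zero_add]
  · rw [wmom_derivFam hζ (n + 1) (by rw [h.degree_eq]; exact_mod_cast Nat.lt_succ_self n),
      h.apply_mul_monic hm (monic_X.mul (hm n))]
    rw [degree_mul, degree_X, h.degree_eq]; push_cast; ring
  · intro k hk
    have hk := Finset.mem_range.1 hk
    rw [wmom_derivFam hζ (n + 1) (by rw [h.degree_eq]; exact_mod_cast hk.trans (Nat.lt_succ_self n)),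
      h.orth, zero_div, C_0, zero_mul]
    rw [degree_mul, degree_X, h.degree_eq]
    have : 1 + k < n + 1 := by omega
    exact_mod_cast this

/-- The Toda equations for two consecutive monic orthogonal polynomials. -/
theorem exists_toda (hζ : 0 < ζ) (n : ℕ) : ∃ a b : ℝ, 0 < a ∧ ∀ x : ℝ,
    HasDerivAt (fun s => (monicOP 0 s (n + 1)).eval x) (a * (monicOP 0 ζ n).eval x) ζ ∧
    HasDerivAt (fun s => (monicOP 0 s n).eval x)
      ((x - b) * (monicOP 0 ζ n).eval x - (monicOP 0 ζ (n + 1)).eval x) ζ := by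
  have h := orthoSeq_monicOP 0 hζ
  have hL := posFunctional_wmom 0 hζ
  have hm := monic_monicOP 0 hζ
  have hder : ∀ m x, HasDerivAt (fun s => (monicOP 0 s m).eval x)
      ((derivFam (fun s => monicOP 0 s m) ζ m).eval x) ζ := fun m x =>
    (coeffDiff_monicOP hζ m).hasDerivAt_eval (eventually_natDegree_monicOP hζ m) x
  -- The recurrence trades the lower neighbour for the upper one, so that only indices n and n + 1
  -- occur. For n = 0 the derivative is zero and `b` is the root of π_1.
  obtain ⟨b, hb⟩ : ∃ b, derivFam (fun s => monicOP 0 s n) ζ n =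
      (X - C b) * monicOP 0 ζ n - monicOP 0 ζ (n + 1) := by
    cases n with
    | zero =>
      obtain ⟨b, hb⟩ := h.exists_one hm
      refine ⟨b, ?_⟩
      have := derivFam_monicOP_degree_lt hζ 0
      rw [zero_add, hb, h.zero_eq_one hm, mul_one, sub_self]
      exact Polynomial.ext fun k => (degree_lt_iff_coeff_zero _ 0).1 this k (by simp)
    | succ n =>
      obtain ⟨b, hb⟩ := h.recurrence hL hm n
      exact ⟨b, by rw [derivFam_monicOP_succ hζ, hb]; ring⟩
  refine ⟨_, b, div_pos (h.sq_pos hL (n + 1)) (h.sq_pos hL n), fun x => ⟨?_, ?_⟩⟩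
  · refine (hder (n + 1) x).congr_deriv ?_
    rw [derivFam_monicOP_succ hζ, eval_mul, eval_C]
  · refine (hder n x).congr_deriv ?_
    rw [hb]
    simp

/-- The Riccati equation for the quotient of consecutive orthogonal polynomials. -/
theorem exists_riccati (hζ : 0 < ζ) (n : ℕ) : ∃ a b : ℝ, 0 < a ∧
    ∀ x : ℝ, (monicOP 0 ζ (n + 1)).eval x ≠ 0 →
    HasDerivAt (fun s => quot (monicOP 0 s n) (monicOP 0 s (n + 1)) x)
      ((x - b) * quot (monicOP 0 ζ n) (monicOP 0 ζ (n + 1)) x - 1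
        - a * quot (monicOP 0 ζ n) (monicOP 0 ζ (n + 1)) x ^ 2) ζ := by
  obtain ⟨a, b, ha, h⟩ := exists_toda hζ n
  refine ⟨a, b, ha, fun x hx => ?_⟩
  refine ((h x).2.div (h x).1 hx).congr_deriv ?_
  rw [quot]
  field_simp

end Toda

end RelOP

namespace RelOP

open Filter Topology Lagrange

/-! ### Labelling the zeros -/

/-- The positive zeros of `Q_{2n}`. -/
noncomputable def posRoots (ζ : ℝ) (n : ℕ) : Finset ℝ :=
  (monicQ ζ n).roots.toFinset.filter (0 < ·)

section Roots

variable {ζ : ℝ}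

theorem mem_posRoots (hζ : 0 < ζ) {n : ℕ} {x : ℝ} :
    x ∈ posRoots ζ n ↔ (monicQ ζ n).eval x = 0 ∧ 0 < x := by
  simp [posRoots, monicQ_ne_zero hζ n]

/-- The n zeros beyond 1 and their negatives are 2n distinct zeros of a polynomial of degree at most
2n. -/
theorem posRoots_spec (hζ : 0 < ζ) (n : ℕ) :
    (posRoots ζ n).card = n ∧ (∀ x ∈ posRoots ζ n, 1 < x) ∧
      (monicQ ζ n).roots.Nodup ∧ (monicQ ζ n).natDegree = 2 * n := by
  classical
  obtain ⟨R, hc, hR⟩ := exists_pos_roots hζ n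
  have hdisj : Disjoint R (R.image Neg.neg) := by
    rw [Finset.disjoint_left]
    intro x hx hx'
    obtain ⟨y, hy, rfl⟩ := Finset.mem_image.1 hx'
    linarith [(hR _ hx).1, (hR _ hy).1]
  have hcard : (R ∪ R.image Neg.neg).card = 2 * n := by
    rw [Finset.card_union_of_disjoint hdisj, Finset.card_image_of_injective _ neg_injective, hc,
      two_mul]
  obtain ⟨h1, h2⟩ := roots_eq_of_card (monicQ_ne_zero hζ n) (T := R ∪ R.image Neg.neg) (by
    intro x hx
    rcases Finset.mem_union.1 hx with hx | hx
    · exact (hR x hx).2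
    · obtain ⟨y, hy, rfl⟩ := Finset.mem_image.1 hx
      rw [eval_neg_monicQ]; exact (hR y hy).2) (by rw [hcard]; exact natDegree_monicQ_le hζ n)
  have hpr : posRoots ζ n = R := by
    ext x
    rw [posRoots, h1, Finset.val_toFinset, Finset.mem_filter, Finset.mem_union]
    constructor
    · rintro ⟨hx | hx, h0⟩
      · exact hx
      · obtain ⟨y, hy, rfl⟩ := Finset.mem_image.1 hx
        linarith [(hR y hy).1]
    · intro hx
      exact ⟨Or.inl hx, zero_lt_one.trans (hR x hx).1⟩
  refine ⟨by rw [hpr, hc], fun x hx => ?_, ?_, by rw [h2, hcard]⟩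
  · rw [hpr] at hx
    exact (hR x hx).1
  · rw [h1]; exact Finset.nodup _

end Roots

/-- The positive zeros of `Q_{2n}` in increasing order. -/
noncomputable def posRoot (ζ : ℝ) (n : ℕ) (k : Fin n) : ℝ :=
  -- The default can occur only for ζ ≤ 0, by `posRoots_spec`.
  if h : (posRoots ζ n).card = n then (posRoots ζ n).orderEmbOfFin h k else 0

/-- The zeros of `Q_{2n}` labelled by `±1, …, ±n` in increasing order. -/
noncomputable def zeroAt (n : ℕ) (i : ℤ) (ζ : ℝ) : ℝ :=
  if h : i.natAbs - 1 < n then i.sign * posRoot ζ n ⟨i.natAbs - 1, h⟩ else 0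

section Labels

variable {ζ : ℝ} {n : ℕ}

theorem posRoot_eq (hζ : 0 < ζ) (k : Fin n) :
    posRoot ζ n k = (posRoots ζ n).orderEmbOfFin (posRoots_spec hζ n).1 k :=
  dif_pos _

theorem strictMono_posRoot (hζ : 0 < ζ) : StrictMono (posRoot ζ n) := by
  intro i j hij
  rw [posRoot_eq hζ, posRoot_eq hζ]
  exact OrderEmbedding.strictMono _ hij

theorem posRoot_mem (hζ : 0 < ζ) (k : Fin n) : posRoot ζ n k ∈ posRoots ζ n := by
  rw [posRoot_eq hζ]; exact Finset.orderEmbOfFin_mem _ _ _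

theorem one_lt_posRoot (hζ : 0 < ζ) (k : Fin n) : 1 < posRoot ζ n k :=
  (posRoots_spec hζ n).2.1 _ (posRoot_mem hζ k)

theorem eval_posRoot (hζ : 0 < ζ) (k : Fin n) : (monicQ ζ n).eval (posRoot ζ n k) = 0 :=
  ((mem_posRoots hζ).1 (posRoot_mem hζ k)).1

theorem exists_posRoot_eq (hζ : 0 < ζ) {x : ℝ} (hx : x ∈ posRoots ζ n) :
    ∃ k, posRoot ζ n k = x := by
  have : x ∈ Set.range ((posRoots ζ n).orderEmbOfFin (posRoots_spec hζ n).1) := by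
    rw [Finset.range_orderEmbOfFin]; exact hx
  obtain ⟨k, hk⟩ := this
  exact ⟨k, by rw [posRoot_eq hζ, hk]⟩

/-- Identifies zeros located by sign changes at a perturbed parameter with the labelled ones. -/
theorem eq_posRoot_of_strictMono (hζ : 0 < ζ) {g : Fin n → ℝ} (hg : StrictMono g)
    (hmem : ∀ k, g k ∈ posRoots ζ n) (k : Fin n) : g k = posRoot ζ n k := by
  rw [posRoot_eq hζ, Finset.orderEmbOfFin_unique (posRoots_spec hζ n).1 hmem hg]

end Labels

/-! ### Motion of the zeros -/

/-- Writing p = (X - r) q, the product is -δ² q(r - δ) q(r + δ), and q(r) ≠ 0. -/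
theorem eventually_sign_change {p : ℝ[X]} {r : ℝ} (h0 : p.eval r = 0)
    (h1 : (derivative p).eval r ≠ 0) :
    ∀ᶠ δ in 𝓝[>] (0 : ℝ), p.eval (r - δ) * p.eval (r + δ) < 0 := by
  obtain ⟨q, rfl⟩ := dvd_iff_isRoot.2 h0
  have hq : q.eval r ≠ 0 := by
    simpa [derivative_mul] using h1
  have hcont : Continuous fun δ : ℝ => q.eval (r - δ) * q.eval (r + δ) := by fun_prop
  have hpos : ∀ᶠ δ in 𝓝 (0 : ℝ), 0 < q.eval (r - δ) * q.eval (r + δ) := by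
    refine hcont.continuousAt.eventually_const_lt ?_
    simpa using hq
  filter_upwards [nhdsWithin_le_nhds hpos, self_mem_nhdsWithin] with δ hδ hδ0
  have hδ0 : 0 < δ := hδ0
  simp only [eval_mul, eval_sub, eval_X, eval_C]
  nlinarith [mul_pos (mul_pos hδ0 hδ0) hδ]

section Motion

variable {ζ : ℝ}

theorem eval_symPoly_eq_zero_iff (hζ : 0 < ζ) (n : ℕ) {x : ℝ} (hx : 1 < x) :
    (symPoly (monicOP 0 ζ n) (monicOP 0 ζ (n + 1))).eval x = 0 ↔ (monicQ ζ n).eval x = 0 := by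
  obtain ⟨α, hα, h⟩ := exists_mul_monicQ hζ n
  have h := congrArg (eval x) h
  have hx2 : x ^ 2 - 1 ≠ 0 := by nlinarith
  simp only [eval_mul, eval_C, eval_sub, eval_pow, eval_X, eval_one] at h
  constructor
  · intro h0
    rw [h0, mul_zero] at h
    exact (mul_eq_zero.1 h).resolve_left hx2
  · intro h0
    rw [h0, mul_zero] at h
    exact (mul_eq_zero.1 h.symm).resolve_left hα

theorem natDegree_symPoly_le (hζ : 0 < ζ) (n : ℕ) :
    (symPoly (monicOP 0 ζ n) (monicOP 0 ζ (n + 1))).natDegree ≤ 2 + 2 * n := by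
  obtain ⟨α, hα, h⟩ := exists_mul_monicQ hζ n
  rw [← natDegree_C_mul hα, ← h]
  refine natDegree_mul_le.trans (add_le_add ?_ (natDegree_monicQ_le hζ n))
  exact (natDegree_X_pow_sub_C (R := ℝ) (n := 2) (r := 1)).le

/-- At a zero `z > 1` of `Q` the function `S(x) + S(-x)` takes the same value as at `1`, and it is
strictly decreasing there. -/
theorem sym_at_root (hζ : 0 < ζ) (n : ℕ) {z : ℝ} (hz : 1 < z) (h0 : (monicQ ζ n).eval z = 0) :
    (monicOP 0 ζ (n + 1)).eval z ≠ 0 ∧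
    (∃ d < 0, HasDerivAt (fun x => quot (monicOP 0 ζ n) (monicOP 0 ζ (n + 1)) x +
      quot (monicOP 0 ζ n) (monicOP 0 ζ (n + 1)) (-x)) d z) ∧
    quot (monicOP 0 ζ n) (monicOP 0 ζ (n + 1)) (-1) <
      quot (monicOP 0 ζ n) (monicOP 0 ζ (n + 1)) (-z) ∧
    quot (monicOP 0 ζ n) (monicOP 0 ζ (n + 1)) 1 <
      quot (monicOP 0 ζ n) (monicOP 0 ζ (n + 1)) (-1) := by
  have ho := orthoSeq_monicOP 0 hζ
  have hL := posFunctional_wmom 0 hζ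
  have hm := monic_monicOP 0 hζ
  set s := (monicOP 0 ζ (n + 1)).roots.toFinset with hs
  have hcard : s.card = n + 1 := ho.card_roots hL (n + 1)
  have hne : s.Nonempty := Finset.card_pos.1 (by omega)
  have hB : monicOP 0 ζ (n + 1) = nodal s id := ho.eq_prod hL hm (n + 1)
  have hroot : ∀ ξ ∈ s, (monicOP 0 ζ (n + 1)).eval ξ = 0 := fun ξ hξ =>
    (mem_roots'.1 (Multiset.mem_toFinset.1 hξ)).2
  have h1 : ∀ ξ ∈ s, 1 < ξ := fun ξ hξ => ho.one_lt_of_isRoot hL (hroot ξ hξ)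
  have hW : ∀ ξ, (monicOP 0 ζ (n + 1)).eval ξ = 0 →
      0 < (derivative (monicOP 0 ζ (n + 1))).eval ξ * (monicOP 0 ζ n).eval ξ := by
    intro ξ hξ
    have := ho.wronskian_pos hL hm n ξ
    rwa [hξ, zero_mul, sub_zero] at this
  obtain ⟨m, hmpos, hpf⟩ := exists_partialFractions (s := s) (A := monicOP 0 ζ n)
    (by rw [ho.degree_eq, hcard]; exact_mod_cast Nat.lt_succ_self n)
    (fun ξ hξ => by have := hW ξ (hroot ξ hξ); rwa [hB] at this)
  rw [← hB] at hpf
  have hBz : (monicOP 0 ζ (n + 1)).eval z ≠ 0 := by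
    -- If B(z) = 0, then `symPoly` reduces to A(z) B(-z) at z: the Wronskian excludes A(z) = 0, and
    -- B has no zero left of 1.
    intro hBz
    have h2 := (eval_symPoly_eq_zero_iff hζ n hz).2 h0
    simp only [symPoly, eval_sub, eval_add, eval_mul, eval_comp, eval_neg, eval_X, eval_C, hBz,
      zero_mul, mul_zero, add_zero, sub_zero] at h2
    rcases mul_eq_zero.1 h2 with h2 | h2
    · have := hW z hBz
      rw [h2, mul_zero] at this
      exact lt_irrefl _ this
    · exact eval_monicOP_ne_zero 0 hζ (n + 1) (by linarith) h2
  have hzs : z ∉ s := fun h => hBz (hroot z h)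
  have hle : ∀ x ≤ 1, x ∉ s := fun x hx h => absurd (h1 x h) (not_lt.2 hx)
  refine ⟨hBz, ?_, ?_, ?_⟩
  · obtain ⟨d, hd, hder⟩ := hasDerivAt_sum_div hne h1 hmpos (zero_lt_one.trans hz) hzs
    refine ⟨d, hd, hder.congr_of_eventuallyEq ?_⟩
    filter_upwards [(s.isClosed.isOpen_compl).mem_nhds (show z ∈ (↑s : Set ℝ)ᶜ from hzs),
      lt_mem_nhds (zero_lt_one.trans hz)] with x hx hx0
    rw [hpf x hx, hpf (-x) (hle _ (by linarith))]
  · rw [hpf _ (hle _ (by norm_num)), hpf _ (hle _ (by linarith))]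
    exact sum_div_neg_lt hne h1 hmpos hz
  · rw [hpf 1 (hle _ le_rfl), hpf (-1) (hle _ (by norm_num))]
    exact sum_div_one_lt hne h1 hmpos

/-- `symPoly` is B(x) B(-x) times a bracket that vanishes at z, so the product rule leaves only the
derivative of the bracket. -/
theorem derivative_symPoly (hζ : 0 < ζ) (n : ℕ) {z d : ℝ} (hz : 1 < z)
    (h0 : (monicQ ζ n).eval z = 0)
    (hd : HasDerivAt (fun x => quot (monicOP 0 ζ n) (monicOP 0 ζ (n + 1)) x +
      quot (monicOP 0 ζ n) (monicOP 0 ζ (n + 1)) (-x)) d z) :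
    quot (monicOP 0 ζ n) (monicOP 0 ζ (n + 1)) z + quot (monicOP 0 ζ n) (monicOP 0 ζ (n + 1)) (-z) =
      symOne (monicOP 0 ζ n) (monicOP 0 ζ (n + 1)) ∧
    (derivative (symPoly (monicOP 0 ζ n) (monicOP 0 ζ (n + 1)))).eval z =
      (monicOP 0 ζ (n + 1)).eval z * (monicOP 0 ζ (n + 1)).eval (-z) * d := by
  set A := monicOP 0 ζ n
  set B := monicOP 0 ζ (n + 1)
  have hBz : B.eval z ≠ 0 := (sym_at_root hζ n hz h0).1
  have hBn : B.eval (-z) ≠ 0 := eval_monicOP_ne_zero 0 hζ (n + 1) (by linarith)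
  have hsym : quot A B z + quot A B (-z) - symOne A B = 0 := by
    have h2 := (eval_symPoly_eq_zero_iff hζ n hz).2 h0
    rw [eval_symPoly _ _ hBz hBn] at h2
    exact (mul_eq_zero.1 h2).resolve_left (mul_ne_zero hBz hBn)
  refine ⟨sub_eq_zero.1 hsym, ?_⟩
  have hev : (fun x => (symPoly A B).eval x) =ᶠ[𝓝 z]
      fun x => B.eval x * (B.comp (-X)).eval x * (quot A B x + quot A B (-x) - symOne A B) := by
    have c1 : ∀ᶠ x in 𝓝 z, B.eval x ≠ 0 := B.continuous.continuousAt.eventually_ne hBz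
    filter_upwards [c1, lt_mem_nhds (zero_lt_one.trans hz)] with x hx hx0
    rw [eval_symPoly _ _ hx (eval_monicOP_ne_zero 0 hζ (n + 1) (by linarith))]
    simp
  have h1 := (symPoly A B).hasDerivAt z
  have h2 := (((B.hasDerivAt z).mul ((B.comp (-X)).hasDerivAt z)).mul
    (hd.sub_const (symOne A B))).congr_of_eventuallyEq hev
  rw [h1.unique h2, hsym, mul_zero, zero_add]
  simp

/-- The `ζ`-derivative of `symPoly` at a zero `z > 1` of `Q`, up to the factor `B(z) B(-z)`. -/
theorem hasDerivAt_symPoly (hζ : 0 < ζ) (n : ℕ) {z : ℝ} (hz : 1 < z)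
    (h0 : (monicQ ζ n).eval z = 0) : ∃ e < 0,
    HasDerivAt (fun s => (symPoly (monicOP 0 s n) (monicOP 0 s (n + 1))).eval z)
      ((monicOP 0 ζ (n + 1)).eval z * (monicOP 0 ζ (n + 1)).eval (-z) * e) ζ := by
  obtain ⟨hBz, ⟨d, -, hd⟩, hlt1, hlt2⟩ := sym_at_root hζ n hz h0
  have hsym := (derivative_symPoly hζ n hz h0 hd).1
  have hBn : (monicOP 0 ζ (n + 1)).eval (-z) ≠ 0 := eval_monicOP_ne_zero 0 hζ (n + 1) (by linarith)
  obtain ⟨a, b, ha, hr⟩ := exists_riccati hζ n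
  obtain ⟨a', b', -, ht⟩ := exists_toda hζ n
  have r1 := hr 1 (eval_monicOP_ne_zero 0 hζ (n + 1) le_rfl)
  have r2 := hr (-1) (eval_monicOP_ne_zero 0 hζ (n + 1) (by norm_num))
  have r3 := hr z hBz
  have r4 := hr (-z) hBn
  have t1 := (ht z).1
  have t2 := (ht (-z)).1
  obtain ⟨e, he, hder⟩ : ∃ e < 0, HasDerivAt
      (fun s => quot (monicOP 0 s n) (monicOP 0 s (n + 1)) z +
        quot (monicOP 0 s n) (monicOP 0 s (n + 1)) (-z) -
        (quot (monicOP 0 s n) (monicOP 0 s (n + 1)) 1 +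
        quot (monicOP 0 s n) (monicOP 0 s (n + 1)) (-1))) e ζ := by
    refine ⟨_, ?_, (r3.add r4).sub (r1.add r2)⟩
    rw [symOne] at hsym
    generalize quot (monicOP 0 ζ n) (monicOP 0 ζ (n + 1)) z = S at *
    generalize quot (monicOP 0 ζ n) (monicOP 0 ζ (n + 1)) (-z) = T at *
    generalize quot (monicOP 0 ζ n) (monicOP 0 ζ (n + 1)) 1 = S1 at *
    generalize quot (monicOP 0 ζ n) (monicOP 0 ζ (n + 1)) (-1) = T1 at *
    have hS : S = S1 + T1 - T := by linarith
    subst hS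
    -- Since S + T = S1 + T1, the terms with `b` cancel and S² + T² - S1² - T1² = 2 (T - T1)(T -
    -- S1). The sum of Riccati terms equals minus (`e1` plus twice `e2` plus twice `e3`), where S1 <
    -- T1 < T.
    have e1 : 0 < (z - 1) * (T1 - S1) := mul_pos (by linarith) (by linarith)
    have e2 : 0 < z * (T - T1) := mul_pos (by linarith) (by linarith)
    have e3 : 0 < a * ((T - T1) * (T - S1)) :=
      mul_pos ha (mul_pos (by linarith) (by linarith))
    nlinarith
  refine ⟨e, he, (((t1.mul t2).mul hder).congr_of_eventuallyEq ?_).congr_deriv ?_⟩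
  · filter_upwards [t1.continuousAt.eventually_ne hBz, t2.continuousAt.eventually_ne hBn]
      with s h1 h2
    rw [eval_symPoly _ _ h1 h2, symOne]
    rfl
  · rw [hsym, symOne, sub_self, mul_zero, zero_add]
    rfl

theorem coeffDiff_symPoly (hζ : 0 < ζ) (n : ℕ) :
    CoeffDiff (fun s => symPoly (monicOP 0 s n) (monicOP 0 s (n + 1))) ζ := by
  have hA := coeffDiff_monicOP hζ n
  have hB := coeffDiff_monicOP hζ (n + 1)
  obtain ⟨a, b, -, hr⟩ := exists_riccati hζ n
  have r1 := hr 1 (eval_monicOP_ne_zero 0 hζ (n + 1) le_rfl)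
  have r2 := hr (-1) (eval_monicOP_ne_zero 0 hζ (n + 1) (by norm_num))
  exact ((hA.mul hB.comp_neg_X).add (hA.comp_neg_X.mul hB)).sub
    (CoeffDiff.C_mul (r1.add r2).differentiableAt (hB.mul hB.comp_neg_X))

theorem eventually_natDegree_symPoly (hζ : 0 < ζ) (n : ℕ) :
    ∀ᶠ s in 𝓝 ζ, (symPoly (monicOP 0 s n) (monicOP 0 s (n + 1))).natDegree ≤ 2 + 2 * n :=
  (lt_mem_nhds hζ).mono fun _ hs => natDegree_symPoly_le hs n

/-- Simple zeros give sign changes across small intervals, and these persist for nearby parameters.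
Disjoint intervals inside (1, ∞) yield n zeros in increasing order, hence all positive zeros with
their labels. -/
theorem continuousAt_posRoot (hζ : 0 < ζ) {n : ℕ} (k : Fin n) :
    ContinuousAt (fun s => posRoot s n k) ζ := by
  rw [Metric.continuousAt_iff']
  intro ε hε
  set r := posRoot ζ n with hr
  set F : ℝ → ℝ[X] := fun s => symPoly (monicOP 0 s n) (monicOP 0 s (n + 1)) with hF
  have hFc : ∀ x, ContinuousAt (fun s => (F s).eval x) ζ := fun x =>
    ((coeffDiff_symPoly hζ n).hasDerivAt_eval (eventually_natDegree_symPoly hζ n) x).continuousAt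
  have c1 : ∀ i : Fin n, ∀ᶠ δ in 𝓝[>] (0 : ℝ),
      (F ζ).eval (r i - δ) * (F ζ).eval (r i + δ) < 0 := by
    intro i
    have hz := one_lt_posRoot hζ i
    have h0 := eval_posRoot hζ i
    refine eventually_sign_change ((eval_symPoly_eq_zero_iff hζ n hz).2 h0) ?_
    obtain ⟨hBz, ⟨d, hd0, hd⟩, -, -⟩ := sym_at_root hζ n hz h0
    rw [(derivative_symPoly hζ n hz h0 hd).2]
    exact mul_ne_zero (mul_ne_zero hBz (eval_monicOP_ne_zero 0 hζ (n + 1) (by linarith))) hd0.ne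
  have small : ∀ t : ℝ, 0 < t → ∀ᶠ δ in 𝓝[>] (0 : ℝ), δ < t := fun t ht =>
    nhdsWithin_le_nhds (gt_mem_nhds ht)
  have c2 : ∀ i : Fin n, ∀ᶠ δ in 𝓝[>] (0 : ℝ), δ < r i - 1 := fun i =>
    small _ (by linarith [one_lt_posRoot hζ i])
  have c3 : ∀ i j : Fin n, i < j → ∀ᶠ δ in 𝓝[>] (0 : ℝ), δ < (r j - r i) / 2 := fun i j hij =>
    small _ (by linarith [strictMono_posRoot hζ hij])
  have c3' : ∀ᶠ δ in 𝓝[>] (0 : ℝ), ∀ i j : Fin n, i < j → δ < (r j - r i) / 2 := by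
    rw [eventually_all]
    intro i
    rw [eventually_all]
    intro j
    by_cases hij : i < j
    · exact (c3 i j hij).mono fun δ h _ => h
    · exact Eventually.of_forall fun δ h => absurd h hij
  -- In order: sign change at each zero, intervals beyond 1, disjoint intervals, accuracy ε, and δ >
  -- 0.
  obtain ⟨δ, h1, h2, h3, h4, h5⟩ := ((eventually_all.2 c1).and ((eventually_all.2 c2).and
    (c3'.and ((small ε hε).and self_mem_nhdsWithin)))).exists
  have h5 : 0 < δ := h5
  have hsign : ∀ᶠ s in 𝓝 ζ, ∀ i : Fin n, (F s).eval (r i - δ) * (F s).eval (r i + δ) < 0 :=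
    eventually_all.2 fun i => ((hFc _).mul (hFc _)).eventually_lt_const (h1 i)
  filter_upwards [hsign, lt_mem_nhds hζ] with s hs hs0
  have hex : ∀ i : Fin n, ∃ c, r i - δ < c ∧ c < r i + δ ∧ (F s).eval c = 0 := fun i =>
    exists_root_between (by linarith) (hs i)
  choose g g1 g2 g3 using hex
  have hg : StrictMono g := fun i j hij => by linarith [g1 j, g2 i, h3 i j hij]
  have hmem : ∀ i, g i ∈ posRoots s n := fun i => by
    have : 1 < g i := by linarith [g1 i, h2 i]
    exact (mem_posRoots hs0).2 ⟨(eval_symPoly_eq_zero_iff hs0 n this).1 (g3 i), by linarith⟩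
  rw [← eq_posRoot_of_strictMono hs0 hg hmem k, Real.dist_eq, abs_lt]
  constructor
  · linarith [g1 k]
  · linarith [g2 k]

/-- The positive zeros of `Q_{2n}` decrease strictly as functions of `ζ`. -/
theorem hasDerivAt_posRoot (hζ : 0 < ζ) {n : ℕ} (k : Fin n) :
    ∃ d < 0, HasDerivAt (fun s => posRoot s n k) d ζ := by
  have hz := one_lt_posRoot hζ k
  have h0 := eval_posRoot hζ k
  obtain ⟨hBz, ⟨d, hd0, hd⟩, -, -⟩ := sym_at_root hζ n hz h0
  have hBn : (monicOP 0 ζ (n + 1)).eval (-posRoot ζ n k) ≠ 0 :=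
    eval_monicOP_ne_zero 0 hζ (n + 1) (by linarith)
  obtain ⟨e, he0, he⟩ := hasDerivAt_symPoly hζ n hz h0
  have hf := (derivative_symPoly hζ n hz h0 hd).2
  have hBB := mul_ne_zero hBz hBn
  have key := hasDerivAt_zero_of_family (eventually_natDegree_symPoly hζ n)
    (coeffDiff_symPoly hζ n) (continuousAt_posRoot hζ k)
    ((lt_mem_nhds hζ).mono fun s hs =>
      (eval_symPoly_eq_zero_iff hs n (one_lt_posRoot hs k)).2 (eval_posRoot hs k))
    he hf (mul_ne_zero hBB hd0.ne)
  refine ⟨_, ?_, key⟩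
  -- The factor B(z) B(-z), whose sign is unknown, cancels and leaves -e/d with e, d < 0.
  rw [← mul_neg, mul_div_mul_left _ _ hBB]
  exact div_neg_of_pos_of_neg (neg_pos.2 he0) hd0

end Motion

end RelOP

namespace RelOP

/-! ### Pencils with a full set of distinct eigenvalues -/

section Pencil

variable {ι : Type*} [Fintype ι] [DecidableEq ι]

theorem eval₂_pencilPoly {K : Type*} [Field K] (f : ℝ →+* K) (A B : Matrix ι ι ℝ) (μ : K) :
    (pencilPoly A B).eval₂ f μ = (μ • A.map f - B.map f).det := by
  rw [pencilPoly, ← coe_eval₂RingHom, RingHom.map_det]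
  congr 1
  ext i j
  simp only [coe_eval₂RingHom, RingHom.mapMatrix_apply, Matrix.map_apply, Matrix.sub_apply,
    Matrix.smul_apply, smul_eq_mul, eval₂_sub, eval₂_mul, eval₂_X, eval₂_C]

theorem isGenEigenvalue_iff {K : Type*} [Field K] (A B : Matrix ι ι K) (μ : K) :
    IsGenEigenvalue A B μ ↔ (μ • A - B).det = 0 := by
  rw [← Matrix.exists_mulVec_eq_zero_iff, IsGenEigenvalue]
  simp only [Matrix.sub_mulVec, Matrix.smul_mulVec, sub_eq_zero, eq_comm]

variable {A B : Matrix ι ι ℝ}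

/-- The coefficient of X to the size of the matrices is det A, so the determinant is nonzero of
degree at most that size, and Λ supplies as many roots. -/
theorem pencilPoly_eq_prod (hA : A.det ≠ 0) {Λ : Finset ℝ} (hc : Λ.card = Fintype.card ι)
    (hΛ : ∀ μ ∈ Λ, IsGenEigenvalue A B μ) :
    pencilPoly A B ≠ 0 ∧ (pencilPoly A B).roots = Λ.val ∧
      (pencilPoly A B).natDegree = Fintype.card ι := by
  have hsub : (pencilPoly A B) = ((X : ℝ[X]) • A.map C + (-B).map C).det := by
    rw [pencilPoly, sub_eq_add_neg]
    congr 2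
    ext i j
    simp
  have h0 : pencilPoly A B ≠ 0 := by
    intro h
    have := coeff_det_X_add_C_card A (-B)
    rw [← hsub, h, coeff_zero] at this
    exact hA this.symm
  have hroot : ∀ μ ∈ Λ, (pencilPoly A B).eval μ = 0 := by
    intro μ hμ
    have := (isGenEigenvalue_iff A B μ).1 (hΛ μ hμ)
    have h2 := eval₂_pencilPoly (RingHom.id ℝ) A B μ
    rw [eval₂_id] at h2
    rw [h2, ← this]
    simp
  have h := roots_eq_of_card h0 hroot (by
    rw [hc, hsub]; exact natDegree_det_X_add_C_le A (-B))
  exact ⟨h0, h.1, h.2.trans hc⟩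

theorem rootMultiplicity_pencilPoly (hA : A.det ≠ 0) {Λ : Finset ℝ}
    (hc : Λ.card = Fintype.card ι) (hΛ : ∀ μ ∈ Λ, IsGenEigenvalue A B μ) {μ : ℝ} (hμ : μ ∈ Λ) :
    (pencilPoly A B).rootMultiplicity μ = 1 := by
  rw [← count_roots, (pencilPoly_eq_prod hA hc hΛ).2.1]
  exact Multiset.count_eq_one_of_mem Λ.nodup hμ

theorem isGenEigenvalue_complex_iff (hA : A.det ≠ 0) {Λ : Finset ℝ}
    (hc : Λ.card = Fintype.card ι) (hΛ : ∀ μ ∈ Λ, IsGenEigenvalue A B μ) (μ : ℂ) :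
    IsGenEigenvalue (A.map Complex.ofReal) (B.map Complex.ofReal) μ ↔ ∃ x ∈ Λ, μ = (x : ℂ) := by
  obtain ⟨h0, hr, hd⟩ := pencilPoly_eq_prod hA hc hΛ
  have hs : (pencilPoly A B).Splits := by
    rw [splits_iff_card_roots, hr, hd, ← hc]; rfl
  have h1 := eval₂_pencilPoly Complex.ofRealHom A B μ
  rw [isGenEigenvalue_iff]
  have h2 : (μ • A.map Complex.ofReal - B.map Complex.ofReal).det =
      (pencilPoly A B).eval₂ Complex.ofRealHom μ := h1.symm
  rw [h2, hs.eq_prod_roots, hr]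
  have h3 : eval₂ Complex.ofRealHom μ (C (pencilPoly A B).leadingCoeff *
      (Multiset.map (fun a => X - C a) Λ.val).prod) =
      Complex.ofRealHom (pencilPoly A B).leadingCoeff * ∏ x ∈ Λ, (μ - x) := by
    rw [eval₂_mul, eval₂_C]
    congr 1
    rw [← Finset.prod, eval₂_finsetProd]
    simp
  rw [h3, mul_eq_zero, or_iff_right (by simpa using h0), Finset.prod_eq_zero_iff]
  simp only [sub_eq_zero]

/-- If there are as many distinct eigenvalues as dimensions, all eigenspaces are lines. -/
theorem genEigenspace_eq_span (hA : A.det ≠ 0) {Λ : Finset ℝ} (hc : Λ.card = Fintype.card ι)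
    (hΛ : ∀ μ ∈ Λ, IsGenEigenvalue A B μ) {μ : ℝ} (hμ : μ ∈ Λ) {y : ι → ℝ} (hy0 : y ≠ 0)
    (hy : B.mulVec y = μ • A.mulVec y) (w : ι → ℝ) :
    B.mulVec w = μ • A.mulVec w ↔ ∃ c : ℝ, w = c • y := by
  constructor
  swap
  · rintro ⟨c, rfl⟩
    rw [Matrix.mulVec_smul, Matrix.mulVec_smul, hy, smul_comm]
  intro hw
  have hU : IsUnit A.det := isUnit_iff_ne_zero.2 hA
  set f := Matrix.toLin' (A⁻¹ * B) with hf
  have happ : ∀ (ν : ℝ) (v : ι → ℝ), B.mulVec v = ν • A.mulVec v → f v = ν • v := by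
    intro ν v hv
    rw [hf, Matrix.toLin'_apply, ← Matrix.mulVec_mulVec, hv, Matrix.mulVec_smul,
      Matrix.mulVec_mulVec, Matrix.nonsing_inv_mul _ hU, Matrix.one_mulVec]
  -- An eigenbasis of A⁻¹B whose member for μ is the given y.
  have hex : ∀ ν : Λ, ∃ v : ι → ℝ, v ≠ 0 ∧ f v = (ν : ℝ) • v ∧ ((ν : ℝ) = μ → v = y) := by
    rintro ⟨ν, hν⟩
    by_cases h : ν = μ
    · subst h
      exact ⟨y, hy0, happ _ _ hy, fun _ => rfl⟩
    · obtain ⟨v, hv0, hv⟩ := hΛ ν hν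
      exact ⟨v, hv0, happ _ _ hv, fun h' => absurd h' h⟩
  choose Y hY0 hYf hYμ using hex
  have hli : LinearIndependent ℝ Y :=
    Module.End.eigenvectors_linearIndependent' f (fun ν : Λ => (ν : ℝ)) Subtype.val_injective Y
      fun ν => Module.End.hasEigenvector_iff.2 ⟨Module.End.mem_eigenspace_iff.2 (hYf ν), hY0 ν⟩
  have hne : Nonempty Λ := ⟨⟨μ, hμ⟩⟩
  set b := basisOfLinearIndependentOfCardEqFinrank hli
    (by rw [Fintype.card_coe, hc, Module.finrank_fintype_fun_eq_card]) with hb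
  have hbY : ∀ ν, b ν = Y ν := fun ν => by
    rw [hb, coe_basisOfLinearIndependentOfCardEqFinrank]
  have hsum : ∑ ν, b.repr w ν • Y ν = w := by
    simpa only [hbY] using b.sum_repr w
  -- Applying f - μ to the expansion of w kills every coordinate with ν ≠ μ.
  have hzero : ∑ ν : Λ, (b.repr w ν * ((ν : ℝ) - μ)) • Y ν = 0 := by
    have h1 : f w = μ • w := happ _ _ hw
    have h2 : f (∑ ν, b.repr w ν • Y ν) = μ • ∑ ν, b.repr w ν • Y ν := by rw [hsum, h1]
    rw [map_sum, Finset.smul_sum, ← sub_eq_zero, ← Finset.sum_sub_distrib] at h2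
    rw [← h2]
    refine Finset.sum_congr rfl fun ν _ => ?_
    rw [map_smul, hYf, smul_smul, smul_smul, ← sub_smul]
    congr 1
    ring
  have hcoef := Fintype.linearIndependent_iff.1 hli _ hzero
  refine ⟨b.repr w ⟨μ, hμ⟩, ?_⟩
  conv_lhs => rw [← hsum]
  rw [Finset.sum_eq_single ⟨μ, hμ⟩, hYμ _ rfl]
  · intro ν _ hν
    have : (ν : ℝ) - μ ≠ 0 := fun h => hν (Subtype.ext (sub_eq_zero.1 h))
    rw [(mul_eq_zero.1 (hcoef ν)).resolve_right this, zero_smul]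
  · intro h
    exact absurd (Finset.mem_univ _) h

end Pencil

/-! ### Orthonormal polynomials and the entries of the matrices -/

section Orthonormal

variable {ζ : ℝ}

theorem degree_P (l : ℕ) (hζ : 0 < ζ) (n : ℕ) : (P l ζ n).degree = n := by
  rw [P, degree_C_mul (sqrt_norm_pos l hζ n).ne', (orthoSeq_monicOP l hζ).degree_eq]

theorem orthoSeq_P (l : ℕ) (hζ : 0 < ζ) : OrthoSeq (wmom l ζ) (P l ζ) where
  degree_eq := degree_P l hζ
  orth n q hq := by
    rw [P, mul_assoc, ← smul_eq_C_mul, map_smul, (orthoSeq_monicOP l hζ).orth n q hq, smul_zero]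

theorem wmom_P_mul_P (l : ℕ) (hζ : 0 < ζ) (n : ℕ) : wmom l ζ (P l ζ n * P l ζ n) = 1 := by
  have hpos := (orthoSeq_monicOP l hζ).sq_pos (posFunctional_wmom l hζ) n
  rw [P, ip_eq l hζ, mul_mul_mul_comm, ← C_mul, ← smul_eq_C_mul, map_smul, smul_eq_mul, ← mul_inv,
    Real.mul_self_sqrt hpos.le, inv_mul_cancel₀ hpos.ne']

theorem lc_pos (l : ℕ) (hζ : 0 < ζ) (n : ℕ) : 0 < lc l ζ n := by
  rw [lc, P, leadingCoeff_mul, leadingCoeff_C, monic_monicOP l hζ n, mul_one]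
  exact sqrt_norm_pos l hζ n

theorem coeff_P_self (l : ℕ) (hζ : 0 < ζ) (n : ℕ) : (P l ζ n).coeff n = lc l ζ n := by
  rw [lc, leadingCoeff, (orthoSeq_P l hζ).natDegree_eq]

/-- The expansion of a polynomial in the orthonormal basis. -/
theorem eval_eq_sum_P (l : ℕ) (hζ : 0 < ζ) {m : ℕ} {f : ℝ[X]} (hf : f.degree < (m : WithBot ℕ))
    (x : ℝ) : f.eval x = ∑ k ∈ Finset.range m, wmom l ζ (f * P l ζ k) * (P l ζ k).eval x := by
  conv_lhs => rw [(orthoSeq_P l hζ).expand (posFunctional_wmom l hζ) m f hf]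
  rw [eval_finsetSum]
  exact Finset.sum_congr rfl fun k _ => by rw [wmom_P_mul_P l hζ, div_one, eval_mul, eval_C]

/-- Only the degree-n part of f is seen by P_n, which explains the ratios of leading coefficients in
p and r. -/
theorem wmom_P_mul_of_degree_le (l : ℕ) (hζ : 0 < ζ) {n : ℕ} {f : ℝ[X]}
    (hf : f.degree < ((n + 1 : ℕ) : WithBot ℕ)) :
    wmom l ζ (f * P l ζ n) = f.coeff n / lc l ζ n := by
  have h := congrArg (fun p => p.coeff n)
    ((orthoSeq_P l hζ).expand (posFunctional_wmom l hζ) (n + 1) f hf)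
  simp only [finsetSum_coeff, coeff_C_mul, wmom_P_mul_P l hζ, div_one] at h
  rw [Finset.sum_range_succ, Finset.sum_eq_zero, zero_add, coeff_P_self l hζ] at h
  · rw [h, mul_div_cancel_right₀ _ (lc_pos l hζ n).ne']
  · intro k hk
    rw [coeff_eq_zero_of_natDegree_lt, mul_zero]
    rw [(orthoSeq_P l hζ).natDegree_eq]
    exact Finset.mem_range.1 hk

theorem coeff_P_pred (l : ℕ) (hζ : 0 < ζ) (n : ℕ) :
    (P l ζ (n + 1)).coeff n = -(lc l ζ (n + 1) * zeroSum l ζ (n + 1)) := by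
  have hs : (P l ζ (n + 1)).Splits := (orthoSeq_P l hζ).splits (posFunctional_wmom l hζ) _
  have h := hs.nextCoeff_eq_neg_sum_roots_mul_leadingCoeff
  have hd := (orthoSeq_P l hζ).natDegree_eq (n + 1)
  rw [nextCoeff_of_natDegree_pos (by omega), hd, Nat.add_sub_cancel] at h
  rw [h, lc, zeroSum]
  ring

theorem degree_X_mul_P (l : ℕ) (hζ : 0 < ζ) (n : ℕ) :
    (X * P l ζ n).degree = ((n + 1 : ℕ) : WithBot ℕ) := by
  rw [degree_mul, degree_X, degree_P l hζ]; push_cast; ring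

theorem degree_sq_mul_P (l : ℕ) (hζ : 0 < ζ) (n : ℕ) :
    ((X ^ 2 - 1) * P l ζ n).degree = ((n + 2 : ℕ) : WithBot ℕ) := by
  have : (X ^ 2 - 1 : ℝ[X]).degree = 2 := degree_X_pow_sub_C two_pos 1
  rw [degree_mul, this, degree_P l hζ]; push_cast; ring

theorem aCoef_eq (l : ℕ) (hζ : 0 < ζ) (n : ℕ) :
    aCoef l ζ n = wmom l ζ (X * P l ζ n * P l ζ (n + 1)) := ip_eq l hζ _ _

theorem bCoef_eq (l : ℕ) (hζ : 0 < ζ) (n : ℕ) :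
    bCoef l ζ n = wmom l ζ (X * P l ζ n * P l ζ n) := ip_eq l hζ _ _

theorem wmom_X_mul_eq_zero (l : ℕ) (hζ : 0 < ζ) {i j : ℕ} (hij : i + 1 < j) :
    wmom l ζ (X * P l ζ i * P l ζ j) = 0 := by
  rw [mul_comm]
  exact (orthoSeq_P l hζ).orth _ _ (by rw [degree_X_mul_P l hζ]; exact_mod_cast hij)

theorem jacobi_apply (l : ℕ) (hζ : 0 < ζ) (m : ℕ) (i j : Fin m) :
    jacobi l ζ m i j = wmom l ζ (X * P l ζ i * P l ζ j) := by
  have hsymm : ∀ i j : ℕ, wmom l ζ (X * P l ζ i * P l ζ j) = wmom l ζ (X * P l ζ j * P l ζ i) :=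
    fun i j => by congr 1; ring
  rw [jacobi, Matrix.of_apply]
  split_ifs with h1 h2 h3
  · rw [h1, bCoef_eq l hζ]
  · rw [h2, aCoef_eq l hζ]
  · rw [h3, aCoef_eq l hζ, hsymm]
  · have h1 : (i : ℕ) ≠ j := fun h => h1 (Fin.ext h)
    rcases lt_or_gt_of_ne h1 with h | h
    · exact (wmom_X_mul_eq_zero l hζ (by omega)).symm
    · rw [hsymm]
      exact (wmom_X_mul_eq_zero l hζ (by omega)).symm

theorem wmom_one_P_mul (ζ : ℝ) (i j : ℕ) : wmom 1 ζ (P 1 ζ i * P 0 ζ j) =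
    wmom 0 ζ ((X ^ 2 - 1) * P 1 ζ i * P 0 ζ j) := by
  rw [wmom_one, mul_assoc]

theorem coeff_sq_mul (f : ℝ[X]) (k : ℕ) :
    ((X ^ 2 - 1) * f).coeff (k + 2) = f.coeff k - f.coeff (k + 2) := by
  rw [sub_mul, one_mul, coeff_sub, coeff_X_pow_mul]

theorem pCoef_eq (hζ : 0 < ζ) (k : ℕ) : pCoef ζ k = wmom 1 ζ (P 1 ζ k * P 0 ζ k) := by
  rw [mul_comm, wmom_P_mul_of_degree_le 1 hζ
    (by rw [degree_P 0 hζ]; exact_mod_cast Nat.lt_succ_self k), coeff_P_self 0 hζ, pCoef]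

theorem rCoef_eq (hζ : 0 < ζ) (k : ℕ) :
    rCoef ζ (k + 1) = wmom 1 ζ (P 1 ζ k * P 0 ζ (k + 2)) := by
  rw [wmom_one_P_mul, wmom_P_mul_of_degree_le 0 hζ
    (by rw [degree_sq_mul_P 1 hζ]; exact_mod_cast Nat.lt_succ_self _), coeff_sq_mul,
    coeff_P_self 1 hζ, coeff_eq_zero_of_natDegree_lt (n := k + 2), sub_zero, rCoef,
    Nat.add_sub_cancel]
  rw [(orthoSeq_P 1 hζ).natDegree_eq]
  omega

/-- Compare the coefficients of x^{k+1} in the three-term expansion of (x² - 1) P_k^(1) in the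
P_j^(0); Vieta turns the subleading coefficients into sums of zeros. -/
theorem qCoef_eq (hζ : 0 < ζ) (k : ℕ) :
    qCoef ζ k = wmom 1 ζ (P 1 ζ k * P 0 ζ (k + 1)) := by
  have h := (orthoSeq_P 0 hζ).expand_add_two (posFunctional_wmom 0 hζ) (m := k)
    (f := (X ^ 2 - 1) * P 1 ζ k)
    (by rw [degree_sq_mul_P 1 hζ]; exact_mod_cast Nat.lt_succ_self _) (by
      intro q hq
      rw [mul_assoc, ← wmom_one]
      exact (orthoSeq_P 1 hζ).orth _ _ hq)
  simp only [wmom_P_mul_P 0 hζ, div_one, ← wmom_one_P_mul] at h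
  rw [← rCoef_eq hζ] at h
  have h := congrArg (fun p => p.coeff (k + 1)) h
  simp only [coeff_add, coeff_C_mul] at h
  rw [coeff_P_self 0 hζ, coeff_P_pred 0 hζ, coeff_eq_zero_of_natDegree_lt (p := P 0 ζ k)
    (by rw [(orthoSeq_P 0 hζ).natDegree_eq]; omega), mul_zero, zero_add] at h
  have hl : ((X ^ 2 - 1) * P 1 ζ k).coeff (k + 1) = -(lc 1 ζ k * zeroSum 1 ζ k) := by
    -- For k = 0 there is no coefficient of index k - 1, matching the empty sum of zeros.
    cases k with
    | zero =>
      have hd := (orthoSeq_P 1 hζ).natDegree_eq 0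
      rw [zeroSum, eq_C_of_natDegree_eq_zero hd, roots_C, Multiset.sum_zero, mul_zero, neg_zero,
        sub_mul, one_mul, coeff_sub, coeff_X_pow_mul']
      simp
    | succ k =>
      rw [coeff_sq_mul, coeff_P_pred 1 hζ, coeff_eq_zero_of_natDegree_lt
        (by rw [(orthoSeq_P 1 hζ).natDegree_eq]; omega), sub_zero]
  rw [hl] at h
  have hc1 := (lc_pos 0 hζ (k + 1)).ne'
  have hc2 := (lc_pos 0 hζ (k + 2)).ne'
  have hr : rCoef ζ (k + 1) * lc 0 ζ (k + 2) = lc 1 ζ k := by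
    rw [rCoef, Nat.add_sub_cancel, div_mul_cancel₀ _ hc2]
  have : wmom 1 ζ (P 1 ζ k * P 0 ζ (k + 1)) * lc 0 ζ (k + 1) =
      lc 1 ζ k * (zeroSum 0 ζ (k + 2) - zeroSum 1 ζ k) := by
    linear_combination -h + zeroSum 0 ζ (k + 2) * hr
  rw [qCoef, div_mul_eq_mul_div, ← this, mul_div_cancel_right₀ _ hc1]

/-- The band is forced: entries left of it vanish by orthogonality for ℓ = 1, those right of it
because (x² - 1) P_i^(1) has degree i + 2. -/
theorem mixed_apply (hζ : 0 < ζ) (m : ℕ) (i : Fin m) (j : Fin (m + 1)) :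
    mixed ζ m i j = wmom 1 ζ (P 1 ζ i * P 0 ζ j) := by
  rw [mixed, Matrix.of_apply]
  split_ifs with h1 h2 h3
  · rw [h1, pCoef_eq hζ]
  · rw [h2, qCoef_eq hζ]
  · rw [h3, rCoef_eq hζ]
  · rcases lt_or_gt_of_ne h1 with h | h
    · exact ((orthoSeq_P 1 hζ).orth _ _ (by rw [degree_P 0 hζ]; exact_mod_cast h)).symm
    · rw [wmom_one_P_mul, mul_comm]
      refine ((orthoSeq_P 0 hζ).orth _ _ ?_).symm
      rw [degree_sq_mul_P 1 hζ]
      exact_mod_cast (by omega : (i : ℕ) + 2 < j)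

/-- The expansion of x P_i uses indices up to m at most; truncation drops the term of index m, which
is the remainder. -/
theorem jacobi_mulVec_Pvec (l : ℕ) (hζ : 0 < ζ) (m : ℕ) (x : ℝ) (i : Fin m) :
    (jacobi l ζ m).mulVec (Pvec l ζ m x) i = x * (P l ζ i).eval x -
      wmom l ζ (X * P l ζ i * P l ζ m) * (P l ζ m).eval x := by
  have h := eval_eq_sum_P l hζ (m := m + 1) (f := X * P l ζ i)
    (by rw [degree_X_mul_P l hζ]; exact_mod_cast Nat.succ_lt_succ i.2) x
  rw [Finset.sum_range_succ, eval_mul, eval_X] at h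
  rw [h, add_sub_cancel_right, Finset.sum_range, Matrix.mulVec, dotProduct]
  exact Finset.sum_congr rfl fun j _ => by rw [jacobi_apply l hζ, Pvec]

theorem mixed_mulVec_Pvec (hζ : 0 < ζ) (m : ℕ) (x : ℝ) (i : Fin m) :
    (mixed ζ m).mulVec (Pvec 0 ζ (m + 1) x) i = (x ^ 2 - 1) * (P 1 ζ i).eval x -
      wmom 1 ζ (P 1 ζ i * P 0 ζ (m + 1)) * (P 0 ζ (m + 1)).eval x := by
  have h := eval_eq_sum_P 0 hζ (m := m + 2) (f := (X ^ 2 - 1) * P 1 ζ i)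
    (by rw [degree_sq_mul_P 1 hζ]; exact_mod_cast (by omega : (i : ℕ) + 2 < m + 2)) x
  simp only [Finset.sum_range_succ _ (m + 1), eval_mul, eval_X, eval_sub, eval_pow, eval_one,
    ← wmom_one_P_mul] at h
  rw [h, add_sub_cancel_right, Finset.sum_range, Matrix.mulVec, dotProduct]
  exact Finset.sum_congr rfl fun j _ => by rw [mixed_apply hζ, Pvec]

theorem mixed_transpose_mulVec_Pvec (hζ : 0 < ζ) (m : ℕ) (x : ℝ) (j : Fin (m + 1)) :
    (mixed ζ m).transpose.mulVec (Pvec 1 ζ m x) j = (P 0 ζ j).eval x -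
      wmom 1 ζ (P 1 ζ m * P 0 ζ j) * (P 1 ζ m).eval x := by
  have h := eval_eq_sum_P 1 hζ (m := m + 1) (f := P 0 ζ j)
    (by rw [degree_P 0 hζ]; exact_mod_cast j.2) x
  rw [Finset.sum_range_succ, mul_comm (P 0 ζ j) (P 1 ζ m)] at h
  rw [h, add_sub_cancel_right, Finset.sum_range, Matrix.mulVec, dotProduct]
  exact Finset.sum_congr rfl fun i _ => by
    rw [Matrix.transpose_apply, mixed_apply hζ, Pvec, mul_comm (P 1 ζ i)]

/-- A kernel vector v would give f = Σ v_k P_k ≠ 0 with (x f, f) = 0, whereas x > 0 on the support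
of the weight. -/
theorem det_jacobi_ne_zero (l : ℕ) (hζ : 0 < ζ) (m : ℕ) : (jacobi l ζ m).det ≠ 0 := by
  intro hdet
  obtain ⟨v, hv0, hv⟩ := Matrix.exists_mulVec_eq_zero_iff.2 hdet
  set f : ℝ[X] := ∑ k : Fin m, C (v k) * P l ζ k with hf
  have hL : ∀ g : ℝ[X], wmom l ζ (g * f) = ∑ k : Fin m, wmom l ζ (g * P l ζ k) * v k := by
    intro g
    rw [hf, Finset.mul_sum, map_sum]
    refine Finset.sum_congr rfl fun k _ => ?_
    rw [mul_left_comm, ← smul_eq_C_mul, map_smul, smul_eq_mul, mul_comm]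
  have hf0 : f ≠ 0 := by
    intro h
    refine hv0 (funext fun i => ?_)
    have := hL (P l ζ i)
    rw [h, mul_zero, map_zero, Finset.sum_eq_single i, wmom_P_mul_P l hζ, one_mul] at this
    · exact this.symm
    · intro j _ hj
      rw [(orthoSeq_P l hζ).orth_of_ne (fun h => hj (Fin.ext h.symm)), zero_mul]
    · intro h
      exact absurd (Finset.mem_univ _) h
  have hrow : ∀ i : Fin m, wmom l ζ (X * P l ζ i * f) = 0 := by
    intro i
    rw [hL]
    have := congrFun hv i
    rw [Pi.zero_apply, Matrix.mulVec, dotProduct] at this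
    rw [← this]
    exact Finset.sum_congr rfl fun j _ => by
      rw [← jacobi_apply l hζ m]
  have hzero : wmom l ζ (X * f * f) = 0 := by
    rw [hL]
    refine Finset.sum_eq_zero fun k _ => ?_
    rw [show X * f * P l ζ k = X * P l ζ k * f by ring, hrow, zero_mul]
  have := posFunctional_wmom l hζ (X * f * f) (mul_ne_zero (mul_ne_zero X_ne_zero hf0) hf0)
    fun x hx => by
      rw [eval_mul, eval_mul, eval_X, mul_assoc]
      exact mul_nonneg (by linarith) (mul_self_nonneg _)
  linarith

theorem det_A0_ne_zero (hζ : 0 < ζ) (n : ℕ) : (A0 ζ n).det ≠ 0 := by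
  rw [A0, Matrix.det_fromBlocks_zero₂₁]
  exact mul_ne_zero (det_jacobi_ne_zero 0 hζ _) (det_jacobi_ne_zero 1 hζ _)

/-! ### The eigenvectors -/

/-- The remainders in P_n^(1)(±z) cancel by the minus sign in v, those in P_{n+1}^(0)(±z) add up to
a multiple of Q(z) = 0. What is left on the two sides differs by the factor √(z² - 1)/z in both
blocks. -/
theorem A1_mulVec_yVec (hζ : 0 < ζ) (n : ℕ) {z : ℝ} (hz : 1 < z ^ 2) (h0 : (Q ζ n).eval z = 0) :
    (A1 ζ n).mulVec (yVec ζ n z) = lamHat z • (A0 ζ n).mulVec (yVec ζ n z) := by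
  have hz0 : z ≠ 0 := by
    rintro rfl
    norm_num at hz
  have hw : Real.sqrt (z ^ 2 - 1) * Real.sqrt (z ^ 2 - 1) = z ^ 2 - 1 :=
    Real.mul_self_sqrt (by linarith)
  simp only [Q, eval_add, eval_mul, eval_comp, eval_neg, eval_X] at h0
  rw [A0, A1, yVec, Matrix.fromBlocks_mulVec, Matrix.fromBlocks_mulVec, lamHat]
  simp only [Sum.elim_comp_inl, Sum.elim_comp_inr, Matrix.zero_mulVec, zero_add, add_zero]
  set w := Real.sqrt (z ^ 2 - 1) with hwdef
  ext k
  rcases k with i | i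
  · simp only [Pi.smul_apply, Sum.elim_inl, smul_eq_mul, uVec, vVec, Matrix.mulVec_smul,
      Matrix.mulVec_add, Matrix.mulVec_sub, Pi.add_apply, Pi.sub_apply,
      mixed_transpose_mulVec_Pvec hζ, jacobi_mulVec_Pvec 0 hζ]
    rw [← hwdef]
    field_simp
    linear_combination w * wmom 0 ζ (X * P 0 ζ i * P 0 ζ (n + 1)) * h0
  · simp only [Pi.smul_apply, Sum.elim_inr, smul_eq_mul, uVec, vVec, Matrix.mulVec_smul,
      Matrix.mulVec_add, Matrix.mulVec_sub, Pi.add_apply, Pi.sub_apply,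
      mixed_mulVec_Pvec hζ, jacobi_mulVec_Pvec 1 hζ]
    rw [← hwdef]
    field_simp
    linear_combination (-z * wmom 1 ζ (P 1 ζ i * P 0 ζ (n + 1))) * h0 -
      z * ((P 1 ζ n).eval (-z) * (P 1 ζ i).eval z + (P 1 ζ n).eval z * (P 1 ζ i).eval (-z)) * hw

/-- The main term of `mixed_mulVec_Pvec` vanishes at x = ±1, and the weights in u make the two
remainders cancel. -/
theorem A1_mulVec_yZero (hζ : 0 < ζ) (n : ℕ) :
    (A1 ζ n).mulVec (yZero ζ n) = (0 : ℝ) • (A0 ζ n).mulVec (yZero ζ n) := by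
  rw [zero_smul, A1, yZero, Matrix.fromBlocks_mulVec]
  simp only [Sum.elim_comp_inl, Sum.elim_comp_inr, Matrix.zero_mulVec,
    Matrix.mulVec_zero, add_zero]
  ext k
  rcases k with i | i
  · rfl
  · simp only [Sum.elim_inr, Matrix.mulVec_smul, Matrix.mulVec_sub, Pi.sub_apply, Pi.smul_apply,
      smul_eq_mul, mixed_mulVec_Pvec hζ, Pi.zero_apply]
    ring

theorem eval_P_ne_zero (l : ℕ) (hζ : 0 < ζ) (n : ℕ) {x : ℝ} (hx : x ≤ 1) :
    (P l ζ n).eval x ≠ 0 := fun h =>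
  absurd ((orthoSeq_P l hζ).one_lt_of_isRoot (posFunctional_wmom l hζ) h) (not_lt.2 hx)

theorem eval_P_zero (l : ℕ) (hζ : 0 < ζ) (x y : ℝ) : (P l ζ 0).eval x = (P l ζ 0).eval y := by
  rw [eq_C_of_natDegree_eq_zero ((orthoSeq_P l hζ).natDegree_eq 0), eval_C, eval_C]

/-- The zeroth entries of u and v are nonzero multiples of the sum and the difference of P_n^(1)(-z)
and P_n^(1)(z). Both vanish only if both values do, but one of ±z is at most 1. -/
theorem yVec_ne_zero (hζ : 0 < ζ) {n : ℕ} (hn : 0 < n) {z : ℝ} (hz : 1 < z ^ 2) :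
    yVec ζ n z ≠ 0 := by
  intro h
  have hu := congrFun h (Sum.inl 0)
  have hv := congrFun h (Sum.inr ⟨0, hn⟩)
  have hw : Real.sqrt (z ^ 2 - 1) ≠ 0 := (Real.sqrt_pos.2 (by linarith)).ne'
  simp only [yVec, Sum.elim_inl, Sum.elim_inr, uVec, vVec, Pi.add_apply, Pi.sub_apply,
    Pi.smul_apply, smul_eq_mul, Pvec, Pi.zero_apply, Fin.val_zero] at hu hv
  have hv := (mul_eq_zero.1 hv).resolve_left hw
  rw [eval_P_zero 0 hζ z 0, eval_P_zero 0 hζ (-z) 0, ← add_mul] at hu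
  rw [eval_P_zero 1 hζ z 0, eval_P_zero 1 hζ (-z) 0, ← sub_mul] at hv
  have hu := (mul_eq_zero.1 hu).resolve_right (eval_P_ne_zero 0 hζ 0 zero_le_one)
  have hv := (mul_eq_zero.1 hv).resolve_right (eval_P_ne_zero 1 hζ 0 zero_le_one)
  rcases le_total z 0 with hz0 | hz0
  · exact eval_P_ne_zero 1 hζ n (x := z) (by linarith) (by linarith)
  · exact eval_P_ne_zero 1 hζ n (x := -z) (by linarith) (by linarith)

theorem yZero_ne_zero (hζ : 0 < ζ) (n : ℕ) : yZero ζ n ≠ 0 := by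
  intro h
  have hu := congrFun h (Sum.inl 0)
  simp only [yZero, Sum.elim_inl, Pi.sub_apply, Pi.smul_apply, smul_eq_mul, Pvec, Pi.zero_apply,
    Fin.val_zero] at hu
  rw [eval_P_zero 0 hζ 1 0, eval_P_zero 0 hζ (-1) 0, ← sub_mul] at hu
  have hu := (mul_eq_zero.1 hu).resolve_right (eval_P_ne_zero 0 hζ 0 zero_le_one)
  simp only [P, eval_mul, eval_C, ← mul_sub] at hu
  have hu := (mul_eq_zero.1 hu).resolve_left (sqrt_norm_pos 0 hζ (n + 1)).ne'
  have ho := orthoSeq_monicOP 0 hζ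
  have hL := posFunctional_wmom 0 hζ
  have hroot : ∀ ξ ∈ (monicOP 0 ζ (n + 1)).roots.toFinset, 1 < ξ := fun ξ hξ =>
    ho.one_lt_of_isRoot hL (mem_roots'.1 (Multiset.mem_toFinset.1 hξ)).2
  have hcard := ho.card_roots hL (n + 1)
  rw [ho.eq_prod hL (monic_monicOP 0 hζ), Lagrange.eval_nodal, Lagrange.eval_nodal] at hu
  -- All zeros exceed 1, so 1 is nearer to each of them than -1; the values at ±1 therefore differ.
  have habs : ∏ ξ ∈ (monicOP 0 ζ (n + 1)).roots.toFinset, |1 - id ξ| <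
      ∏ ξ ∈ (monicOP 0 ζ (n + 1)).roots.toFinset, |-1 - id ξ| := by
    refine Finset.prod_lt_prod_of_nonempty (fun ξ hξ => ?_) (fun ξ hξ => ?_)
      (Finset.card_pos.1 (by omega))
    · have := hroot ξ hξ
      exact abs_pos.2 (by simp only [id]; linarith)
    · have := hroot ξ hξ
      simp only [id]
      rw [abs_of_neg (by linarith), abs_of_neg (by linarith)]
      linarith
  rw [← Finset.abs_prod, ← Finset.abs_prod, sub_eq_zero.1 hu] at habs
  exact lt_irrefl _ habs

end Orthonormal

end RelOP

namespace RelOP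

/-! ### The zeros under the labels ±1, …, ±n. -/

section Final

variable {ζ : ℝ} {n : ℕ}

theorem zeroAt_of_pos (k : Fin n) (ζ : ℝ) : zeroAt n ((k : ℤ) + 1) ζ = posRoot ζ n k := by
  have h1 : ((k : ℤ) + 1).natAbs = (k : ℕ) + 1 := by omega
  have h2 : ((k : ℤ) + 1).sign = 1 := Int.sign_eq_one_of_pos (by omega)
  rw [zeroAt, dif_pos (by rw [h1]; exact k.2), h2, Int.cast_one, one_mul]
  congr 1

theorem zeroAt_neg (i : ℤ) (ζ : ℝ) : zeroAt n (-i) ζ = -zeroAt n i ζ := by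
  simp only [zeroAt, Int.natAbs_neg, Int.sign_neg, Int.cast_neg]
  split_ifs <;> ring

theorem neg_mem_idx {i : ℤ} (hi : i ∈ idx n) : -i ∈ idx n :=
  ⟨neg_ne_zero.2 hi.1, by rw [abs_neg]; exact hi.2⟩

theorem exists_fin_of_mem_idx {i : ℤ} (hi : i ∈ idx n) (h : 0 < i) :
    ∃ k : Fin n, i = (k : ℤ) + 1 := by
  have h2 := hi.2
  rw [abs_of_pos h] at h2
  exact ⟨⟨(i - 1).toNat, by omega⟩, by simp only; omega⟩

theorem mem_idx_of_fin (k : Fin n) : (k : ℤ) + 1 ∈ idx n := by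
  have := k.2
  refine ⟨by omega, ?_⟩
  rw [abs_of_pos (by omega)]
  omega

theorem one_lt_zeroAt (hζ : 0 < ζ) {i : ℤ} (hi : i ∈ idx n) (h : 0 < i) : 1 < zeroAt n i ζ := by
  obtain ⟨k, rfl⟩ := exists_fin_of_mem_idx hi h
  rw [zeroAt_of_pos]
  exact one_lt_posRoot hζ k

theorem zeroAt_lt_neg_one (hζ : 0 < ζ) {i : ℤ} (hi : i ∈ idx n) (h : i < 0) :
    zeroAt n i ζ < -1 := by
  have := one_lt_zeroAt hζ (neg_mem_idx hi) (by omega)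
  rw [zeroAt_neg] at this
  linarith

theorem zeroAt_lt_of_pos (hζ : 0 < ζ) {i j : ℤ} (hi : i ∈ idx n) (hj : j ∈ idx n) (h : 0 < i)
    (hij : i < j) : zeroAt n i ζ < zeroAt n j ζ := by
  obtain ⟨k, rfl⟩ := exists_fin_of_mem_idx hi h
  obtain ⟨m, rfl⟩ := exists_fin_of_mem_idx hj (by omega)
  rw [zeroAt_of_pos, zeroAt_of_pos]
  exact strictMono_posRoot hζ (by rw [Fin.lt_def]; omega)

theorem zeroAt_lt (hζ : 0 < ζ) {i j : ℤ} (hi : i ∈ idx n) (hj : j ∈ idx n) (hij : i < j) :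
    zeroAt n i ζ < zeroAt n j ζ := by
  rcases lt_or_gt_of_ne hi.1 with h | h
  · rcases lt_or_gt_of_ne hj.1 with h' | h'
    · have := zeroAt_lt_of_pos hζ (neg_mem_idx hj) (neg_mem_idx hi) (by omega) (by omega)
      rw [zeroAt_neg, zeroAt_neg] at this
      linarith
    · linarith [zeroAt_lt_neg_one hζ hi h, one_lt_zeroAt hζ hj h']
  · exact zeroAt_lt_of_pos hζ hi hj h hij

theorem one_lt_zeroAt_sq (hζ : 0 < ζ) {i : ℤ} (hi : i ∈ idx n) : 1 < zeroAt n i ζ ^ 2 := by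
  rcases lt_or_gt_of_ne hi.1 with h | h
  · nlinarith [zeroAt_lt_neg_one hζ hi h]
  · nlinarith [one_lt_zeroAt hζ hi h]

theorem eval_monicQ_eq_zero_iff (hζ : 0 < ζ) (x : ℝ) :
    (monicQ ζ n).eval x = 0 ↔ ∃ i ∈ idx n, x = zeroAt n i ζ := by
  have hpos : ∀ x, 0 < x → (monicQ ζ n).eval x = 0 → ∃ i ∈ idx n, x = zeroAt n i ζ := by
    intro x hx h
    obtain ⟨k, rfl⟩ := exists_posRoot_eq hζ ((mem_posRoots hζ).2 ⟨h, hx⟩)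
    exact ⟨_, mem_idx_of_fin k, (zeroAt_of_pos k ζ).symm⟩
  constructor
  · intro h
    rcases lt_trichotomy x 0 with hx | hx | hx
    · obtain ⟨i, hi, he⟩ := hpos (-x) (by linarith) (by rw [eval_neg_monicQ, h])
      exact ⟨-i, neg_mem_idx hi, by rw [zeroAt_neg, ← he, neg_neg]⟩
    · exfalso
      have h1 := eval_monicOP_ne_zero 0 hζ (n + 1) (zero_le_one (α := ℝ))
      have h2 := eval_monicOP_ne_zero 1 hζ n (zero_le_one (α := ℝ))
      simp only [hx, monicQ, eval_add, eval_mul, eval_comp, eval_neg, eval_X, neg_zero] at h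
      exact mul_ne_zero h1 h2 (by linarith)
    · exact hpos x hx h
  · have : ∀ i ∈ idx n, 0 < i → (monicQ ζ n).eval (zeroAt n i ζ) = 0 := by
      intro i hi h
      obtain ⟨k, rfl⟩ := exists_fin_of_mem_idx hi h
      rw [zeroAt_of_pos]
      exact eval_posRoot hζ k
    rintro ⟨i, hi, rfl⟩
    rcases lt_or_gt_of_ne hi.1 with h | h
    · rw [← eval_neg_monicQ, ← zeroAt_neg]
      exact this _ (neg_mem_idx hi) (by omega)
    · exact this i hi h

/-! ### The map `z ↦ √(z² - 1)/z` -/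

theorem lamHat_neg (z : ℝ) : lamHat (-z) = -lamHat z := by
  rw [lamHat, lamHat, neg_sq, div_neg]

theorem lamHat_sq {z : ℝ} (hz : 1 < z ^ 2) : lamHat z ^ 2 = 1 - 1 / z ^ 2 := by
  rw [lamHat, div_pow, Real.sq_sqrt (by linarith), sub_div, div_self (by positivity)]

theorem lamHat_ne_zero {z : ℝ} (hz : 1 < z ^ 2) : lamHat z ≠ 0 := by
  have : z ≠ 0 := by
    rintro rfl
    norm_num at hz
  exact div_ne_zero (Real.sqrt_pos.2 (by linarith)).ne' this

theorem abs_lamHat_lt_one {z : ℝ} (hz : 1 < z ^ 2) : |lamHat z| < 1 := by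
  rw [← sq_lt_one_iff_abs_lt_one, lamHat_sq hz]
  have : 0 < 1 / z ^ 2 := by positivity
  linarith

/-- The square 1 - 1/z² determines z², and oddness together with nonvanishing determines the sign.
-/
theorem lamHat_injOn {z w : ℝ} (hz : 1 < z ^ 2) (hw : 1 < w ^ 2) (h : lamHat z = lamHat w) :
    z = w := by
  have h2 := congrArg (· ^ 2) h
  simp only [lamHat_sq hz, lamHat_sq hw] at h2
  have h3 : z ^ 2 = w ^ 2 := by
    have h4 : (z ^ 2)⁻¹ = (w ^ 2)⁻¹ := by
      rw [← one_div, ← one_div]; linarith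
    exact inv_injective h4
  rcases sq_eq_sq_iff_eq_or_eq_neg.1 h3 with h4 | h4
  · exact h4
  · exfalso
    rw [h4, lamHat_neg] at h
    exact lamHat_ne_zero hw (by linarith)

theorem hasDerivAt_lamHat {z : ℝ} (hz : 1 < z) : ∃ d > 0, HasDerivAt lamHat d z := by
  have h0 : 0 < z ^ 2 - 1 := by nlinarith
  have hs := Real.sqrt_pos.2 h0
  have h1 : HasDerivAt (fun x : ℝ => x ^ 2 - 1) (2 * z) z := by
    simpa using (hasDerivAt_pow 2 z).sub_const 1
  have h2 := (h1.sqrt h0.ne').div (hasDerivAt_id z) (by simp only [id]; linarith)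
  refine ⟨_, ?_, h2⟩
  refine div_pos ?_ (by simp only [id]; positivity)
  simp only [id]
  have : 2 * z / (2 * Real.sqrt (z ^ 2 - 1)) * z - Real.sqrt (z ^ 2 - 1) * 1 =
      1 / Real.sqrt (z ^ 2 - 1) := by
    field_simp
    rw [Real.sq_sqrt h0.le]
    ring
  rw [this]
  positivity

theorem hasDerivAt_lamHat_zeroAt (hζ : 0 < ζ) {i : ℤ} (hi : i ∈ idx n) (h : 0 < i) :
    ∃ d : ℝ, HasDerivAt (fun s => lamHat (zeroAt n i s)) d ζ ∧ d < 0 := by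
  obtain ⟨k, rfl⟩ := exists_fin_of_mem_idx hi h
  simp only [zeroAt_of_pos]
  obtain ⟨e, he, hpos⟩ := hasDerivAt_posRoot hζ k
  obtain ⟨d, hd, hl⟩ := hasDerivAt_lamHat (one_lt_posRoot hζ k)
  have hcomp : HasDerivAt (lamHat ∘ fun s => posRoot s n k) (d * e) ζ := HasDerivAt.comp ζ hl hpos
  exact ⟨d * e, hcomp, mul_neg_of_pos_of_neg hd he⟩

/-! ### The spectrum of the pencil -/

theorem idx_eq_coe (n : ℕ) : (idx n) = ((Finset.Icc (-n : ℤ) n).erase 0 : Finset ℤ) := by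
  ext i
  simp [idx, abs_le, and_comm]

/-- The `2n + 1` generalized eigenvalues. -/
noncomputable def eigenvalueSet (ζ : ℝ) (n : ℕ) : Finset ℝ :=
  insert 0 (((Finset.Icc (-n : ℤ) n).erase 0).image fun i => lamHat (zeroAt n i ζ))

theorem mem_eigenvalueSet {x : ℝ} :
    x ∈ eigenvalueSet ζ n ↔ x = 0 ∨ ∃ i ∈ idx n, x = lamHat (zeroAt n i ζ) := by
  rw [eigenvalueSet, Finset.mem_insert, Finset.mem_image, idx_eq_coe]
  simp only [Finset.mem_coe, eq_comm]

theorem lamHat_zeroAt_injOn (hζ : 0 < ζ) {i j : ℤ} (hi : i ∈ idx n) (hj : j ∈ idx n)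
    (h : lamHat (zeroAt n i ζ) = lamHat (zeroAt n j ζ)) : i = j := by
  have h := lamHat_injOn (one_lt_zeroAt_sq hζ hi) (one_lt_zeroAt_sq hζ hj) h
  rcases lt_trichotomy i j with hij | hij | hij
  · exact absurd h (zeroAt_lt hζ hi hj hij).ne
  · exact hij
  · exact absurd h (zeroAt_lt hζ hj hi hij).ne'

theorem card_eigenvalueSet (hζ : 0 < ζ) (n : ℕ) :
    (eigenvalueSet ζ n).card = Fintype.card (Fin (n + 1) ⊕ Fin n) := by
  rw [eigenvalueSet, Finset.card_insert_of_notMem, Finset.card_image_of_injOn]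
  · rw [Finset.card_erase_of_mem (by simp), Int.card_Icc, Fintype.card_sum, Fintype.card_fin,
      Fintype.card_fin]
    omega
  · rw [← idx_eq_coe]
    intro i hi j hj h
    exact lamHat_zeroAt_injOn hζ hi hj h
  · intro h
    obtain ⟨i, hi, h⟩ := Finset.mem_image.1 h
    rw [← Finset.mem_coe, ← idx_eq_coe] at hi
    exact lamHat_ne_zero (one_lt_zeroAt_sq hζ hi) h

theorem yVec_zeroAt (hζ : 0 < ζ) {i : ℤ} (hi : i ∈ idx n) : yVec ζ n (zeroAt n i ζ) ≠ 0 ∧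
    (A1 ζ n).mulVec (yVec ζ n (zeroAt n i ζ)) =
      lamHat (zeroAt n i ζ) • (A0 ζ n).mulVec (yVec ζ n (zeroAt n i ζ)) := by
  have hn : 0 < n := by
    have h1 := hi.2
    have h2 := abs_pos.2 hi.1
    omega
  obtain ⟨c, -, hQ⟩ := Q_eq_C_mul hζ n
  refine ⟨yVec_ne_zero hζ hn (one_lt_zeroAt_sq hζ hi),
    A1_mulVec_yVec hζ n (one_lt_zeroAt_sq hζ hi) ?_⟩
  rw [hQ, eval_mul, (eval_monicQ_eq_zero_iff hζ _).2 ⟨i, hi, rfl⟩, mul_zero]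

theorem isGenEigenvalue_of_mem (hζ : 0 < ζ) {μ : ℝ} (hμ : μ ∈ eigenvalueSet ζ n) :
    IsGenEigenvalue (A0 ζ n) (A1 ζ n) μ := by
  rcases mem_eigenvalueSet.1 hμ with rfl | ⟨i, hi, rfl⟩
  · exact ⟨_, yZero_ne_zero hζ n, A1_mulVec_yZero hζ n⟩
  · exact ⟨_, yVec_zeroAt hζ hi⟩

end Final

end RelOP

/-! ### The main theorem. -/

theorem mainTheorem3 (n : ℕ) :
    ∃ z : ℤ → ℝ → ℝ, ∀ ζ : ℝ, 0 < ζ →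
      -- `Q_{2n}` is even of degree `2n`; its zeros are the simple zeros `z_i`, `i = ±1, …, ±n`
      ((RelOP.Q ζ n).comp (-Polynomial.X) = RelOP.Q ζ n ∧
        (RelOP.Q ζ n).natDegree = 2 * n ∧
        (∀ x : ℝ, (RelOP.Q ζ n).IsRoot x ↔ ∃ i ∈ idx n, x = z i ζ) ∧
        (∀ i ∈ idx n, (RelOP.Q ζ n).rootMultiplicity (z i ζ) = 1) ∧
        (∀ i ∈ idx n, 0 < i → 1 < z i ζ) ∧
        (∀ i ∈ idx n, z (-i) ζ = -z i ζ) ∧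
        (∀ i ∈ idx n, ∀ j ∈ idx n, i < j → z i ζ < z j ζ)) ∧
      -- the generalized eigenvalues, real and complex, are `0` and the `2n` numbers `λ̂_i`
      (∀ μ : ℂ, IsGenEigenvalue ((A0 ζ n).map Complex.ofReal) ((A1 ζ n).map Complex.ofReal) μ ↔
        μ = 0 ∨ ∃ i ∈ idx n, μ = (lamHat (z i ζ) : ℂ)) ∧
      -- `0` and the `λ̂_i` are simple, the `λ̂_i` are nonzero, distinct, of modulus less than one
      (pencilPoly (A0 ζ n) (A1 ζ n)).rootMultiplicity 0 = 1 ∧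
      (∀ i ∈ idx n, (pencilPoly (A0 ζ n) (A1 ζ n)).rootMultiplicity (lamHat (z i ζ)) = 1) ∧
      (∀ i ∈ idx n, lamHat (z i ζ) ≠ 0 ∧ |lamHat (z i ζ)| < 1) ∧
      (∀ i ∈ idx n, ∀ j ∈ idx n, lamHat (z i ζ) = lamHat (z j ζ) → i = j) ∧
      -- dependence on `ζ`
      (∀ i ∈ idx n, 0 < i → ∃ d : ℝ, HasDerivAt (fun s => lamHat (z i s)) d ζ ∧ d < 0) ∧
      (∀ i ∈ idx n, i < 0 → ∃ d : ℝ, HasDerivAt (fun s => lamHat (z i s)) d ζ ∧ 0 < d) ∧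
      -- the eigenvectors, each unique up to a scalar factor
      (∀ i ∈ idx n, yVec ζ n (z i ζ) ≠ 0 ∧
        ∀ y : Fin (n + 1) ⊕ Fin n → ℝ,
          (A1 ζ n).mulVec y = lamHat (z i ζ) • (A0 ζ n).mulVec y ↔
            ∃ c : ℝ, y = c • yVec ζ n (z i ζ)) ∧
      (yZero ζ n ≠ 0 ∧
        ∀ y : Fin (n + 1) ⊕ Fin n → ℝ,
          (A1 ζ n).mulVec y = (0 : ℝ) • (A0 ζ n).mulVec y ↔ ∃ c : ℝ, y = c • yZero ζ n) := by
  refine ⟨zeroAt n, fun ζ hζ => ?_⟩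
  obtain ⟨c, hc, hQ⟩ := Q_eq_C_mul hζ n
  have hdet := det_A0_ne_zero hζ n
  have hcard := card_eigenvalueSet hζ n
  have hgen : ∀ μ ∈ eigenvalueSet ζ n, IsGenEigenvalue (A0 ζ n) (A1 ζ n) μ :=
    fun μ hμ => isGenEigenvalue_of_mem hζ hμ
  have hmem : ∀ i ∈ idx n, lamHat (zeroAt n i ζ) ∈ eigenvalueSet ζ n := fun i hi =>
    mem_eigenvalueSet.2 (Or.inr ⟨i, hi, rfl⟩)
  have hmem0 : (0 : ℝ) ∈ eigenvalueSet ζ n := mem_eigenvalueSet.2 (Or.inl rfl)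
  refine ⟨⟨?_, ?_, ?_, ?_, ?_, ?_, ?_⟩, ?_, ?_, ?_, ?_, ?_, ?_, ?_, ?_, ?_⟩
  · rw [hQ, Polynomial.mul_comp, Polynomial.C_comp, monicQ_comp_neg]
  · rw [hQ, Polynomial.natDegree_C_mul hc.ne', (posRoots_spec hζ n).2.2.2]
  · intro x
    rw [Polynomial.IsRoot, hQ, Polynomial.eval_mul, Polynomial.eval_C, mul_eq_zero,
      or_iff_right hc.ne']
    exact eval_monicQ_eq_zero_iff hζ x
  · intro i hi
    rw [hQ, ← Polynomial.count_roots, Polynomial.roots_C_mul _ hc.ne']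
    refine Multiset.count_eq_one_of_mem (posRoots_spec hζ n).2.2.1 ?_
    exact (Polynomial.mem_roots (monicQ_ne_zero hζ n)).2
      ((eval_monicQ_eq_zero_iff hζ _).2 ⟨i, hi, rfl⟩)
  · exact fun i hi h => one_lt_zeroAt hζ hi h
  · exact fun i _ => zeroAt_neg i ζ
  · exact fun i hi j hj hij => zeroAt_lt hζ hi hj hij
  · intro μ
    rw [isGenEigenvalue_complex_iff hdet hcard hgen]
    constructor
    · rintro ⟨x, hx, rfl⟩
      rcases mem_eigenvalueSet.1 hx with rfl | ⟨i, hi, rfl⟩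
      · exact Or.inl Complex.ofReal_zero
      · exact Or.inr ⟨i, hi, rfl⟩
    · rintro (rfl | ⟨i, hi, rfl⟩)
      · exact ⟨0, hmem0, Complex.ofReal_zero.symm⟩
      · exact ⟨_, hmem i hi, rfl⟩
  · exact rootMultiplicity_pencilPoly hdet hcard hgen hmem0
  · exact fun i hi => rootMultiplicity_pencilPoly hdet hcard hgen (hmem i hi)
  · exact fun i hi => ⟨lamHat_ne_zero (one_lt_zeroAt_sq hζ hi),
      abs_lamHat_lt_one (one_lt_zeroAt_sq hζ hi)⟩
  · exact fun i hi j hj h => lamHat_zeroAt_injOn hζ hi hj h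
  · exact fun i hi h => hasDerivAt_lamHat_zeroAt hζ hi h
  · intro i hi h
    -- Negative labels follow from positive ones, as both `zeroAt` in its label and `lamHat` are
    -- odd.
    obtain ⟨d, hd, hd0⟩ := hasDerivAt_lamHat_zeroAt hζ (neg_mem_idx hi) (by omega)
    simp only [zeroAt_neg, lamHat_neg] at hd
    exact ⟨-d, by simpa using hd.fun_neg, by linarith⟩
  · exact fun i hi => ⟨(yVec_zeroAt hζ hi).1, genEigenspace_eq_span hdet hcard hgen (hmem i hi)
      (yVec_zeroAt hζ hi).1 (yVec_zeroAt hζ hi).2⟩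
  · exact ⟨yZero_ne_zero hζ n, genEigenspace_eq_span hdet hcard hgen hmem0
      (yZero_ne_zero hζ n) (A1_mulVec_yZero hζ n)⟩
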